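/- Let $\varepsilon,\tau>0$ and let $$K(x,y)=\exp\Big(-\tfrac12\varepsilon^2(x^2+y^2)+\tau^2\varepsilon^2xy\Big),\qquad x,y\in[-1,1],$$ be the analytic Hermite (Mehler) kernel. It is the weighted power series kernel $K(x,y)=\varphi(x)\varphi(y)\sum_{k=0}^\infty\alpha_k^{-1}x^ky^k$ with $\alpha_k=(\tau\varepsilon)^{-2k}k!$ and $\varphi(x)=e^{-\frac12\varepsilon^2x^2}$. Let $H(K)$, with norm $\|\cdot\|_K$, be its reproducing kernel Hilbert space, a space of real functions on $[-1,1]$. Consider linear approximations of the form $$A_nf=\sum_{k=1}^nf(x_k)\,\psi_k \qquad (\ast)$$ with pairwise distinct points $x_1,\dots,x_n\in[-1,1]$ and Lebesgue measurable functions $\psi_k\colon[-1,1]\to\mathbb R$. With $\|g\|_\infty=\sup_{x\in[-1,1]}|g(x)|\in[0,\infty]$, put $$e_\infty(A_n)=\sup_{0\ne f\in H(K)}\frac{\|f-A_nf\|_\infty}{\|f\|_K},\qquad e_\infty^{\min}(n)=\inf_{A_n}e_\infty(A_n),$$ where the infimum is over all approximations of the form $(\ast)$. For $\lambda>0$ let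 $$c_L(\lambda)=\frac{e^{-\frac32\lambda+2\sqrt\lambda}}{2\sqrt\pi\,\lambda^{1/4}}\Big(3+\sqrt{\tfrac{\pi}{e}}+\frac{2}{\sqrt\pi\,\lambda^{1/4}}+\frac{7}{16\sqrt\lambda}+\sqrt\lambda\,(2+\lambda)\Big),\qquad m_L(\lambda)=\max\Big\{5\lambda,\ \lambda\big(1+\tfrac\lambda2\big)^2,\ \frac9\lambda\Big\},$$ and set $$c_1=\sqrt{\frac{2}{1+\tau^2\varepsilon^2}}\;e^{-(\frac1{32}\tau^4\varepsilon^4+\frac12\varepsilon^2)},\qquad c_2=2\sqrt{c_L(\tau^2\varepsilon^2)}.$$ Then for every integer $n\ge m_L(\tau^2\varepsilon^2)$ $$c_1\Big(\frac{\tau\varepsilon}2\Big)^n(n!)^{-1/2}\le e_\infty^{\min}(n)\le c_2\,n^{-1/8}e^{\tau\varepsilon\sqrt n}\Big(\frac{\tau\varepsilon}2\Big)^n(n!)^{-1/2},$$ and for any pairwise distinct $x_1,\dots,x_n\in[-1,1]$ there is a linear approximation $A_n$ of the form $(\ast)$ that uses these points and satisfies $$c_1\Big(\frac{\tau\varepsilon}2\Big)^n(n!)^{-1/2}\le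 e_\infty(A_n)\le \frac{c_2}2\,n^{-1/8}e^{\tau\varepsilon\sqrt n}\,(2\tau\varepsilon)^n(n!)^{-1/2}.$$ -/

import Mathlib

open scoped ENNReal

noncomputable section

/-- The interval `[-1, 1]`. -/
abbrev SymInterval : Type := Set.Icc (-1 : ℝ) 1

/-- The weighted power series kernel `φ(x) φ(y) ∑ₖ αₖ⁻¹ xᵏ yᵏ` on `[-1, 1]`. -/
def weightedPowerSeriesKernel (α : ℕ → ℝ) (φ : SymInterval → ℝ) (x y : SymInterval) : ℝ :=
  φ x * φ y * ∑' k : ℕ, (α k)⁻¹ * (x : ℝ) ^ k * (y : ℝ) ^ k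

/-- The analytic Hermite (Mehler) kernel on `[-1, 1]`. -/
def analyticHermiteKernel (ε τ : ℝ) (x y : SymInterval) : ℝ :=
  Real.exp (-(1 / 2) * ε ^ 2 * ((x : ℝ) ^ 2 + (y : ℝ) ^ 2) + τ ^ 2 * ε ^ 2 * ((x : ℝ) * (y : ℝ)))

/-- The uniform norm `sup_{x ∈ [-1, 1]} |f x|`, with values in `[0, ∞]`. -/
def supNorm (f : SymInterval → ℝ) : ℝ≥0∞ := ⨆ x : SymInterval, ‖f x‖ₑ

/-- The data of a linear approximation `A f = ∑ₖ f(xₖ) ψₖ` that uses `n` function evaluations: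
pairwise distinct points `xₖ ∈ [-1, 1]` and Lebesgue measurable functions `ψₖ` on `[-1, 1]`. -/
structure LinearApprox (n : ℕ) where
  /-- the points `xₖ` -/
  node : Fin n → SymInterval
  node_injective : Function.Injective node
  /-- the functions `ψₖ` -/
  weight : Fin n → SymInterval → ℝ
  weight_measurable : ∀ k, MeasureTheory.NullMeasurable (weight k)
    (MeasureTheory.Measure.comap Subtype.val (MeasureTheory.volume : MeasureTheory.Measure ℝ))

/-- The function `A f = ∑ₖ f(xₖ) ψₖ`. -/
def LinearApprox.apply {n : ℕ} (A : LinearApprox n) (f : SymInterval → ℝ) : SymInterval → ℝ :=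
  fun x => ∑ k : Fin n, f (A.node k) * A.weight k x

section Errors

variable (H : Type*) [NormedAddCommGroup H] [InnerProductSpace ℝ H] [RKHS ℝ H SymInterval ℝ]

/-- The Hilbert space of functions `H` on `[-1, 1]` is the reproducing kernel Hilbert space of the
real-valued kernel `K`. Mathlib's kernel takes values in the linear maps `ℝ →L[ℝ] ℝ`, which are
identified with real numbers through their value at `1`. -/
def HasReproducingKernel [CompleteSpace H] (K : SymInterval → SymInterval → ℝ) : Prop :=
  ∀ x y : SymInterval, RKHS.kernel H x y 1 = K x y

/-- The worst-case error `e_∞(A) = sup_{0 ≠ f ∈ H} ‖f - A f‖_∞ / ‖f‖_H`. -/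
def worstCaseError {n : ℕ} (A : LinearApprox n) : ℝ≥0∞ :=
  ⨆ (f : H) (_ : f ≠ 0), supNorm (fun x => f x - A.apply (⇑f) x) / ‖f‖ₑ

/-- The `n`th minimal error `inf_A e_∞(A)`. -/
def minimalError (n : ℕ) : ℝ≥0∞ := ⨅ A : LinearApprox n, worstCaseError H A

end Errors

/-- The function `c_L`. -/
def cL (l : ℝ) : ℝ :=
  Real.exp (-(3 / 2) * l + 2 * √l) / (2 * √Real.pi * l ^ (1 / 4 : ℝ)) *
    (3 + √(Real.pi / Real.exp 1) + 2 / (√Real.pi * l ^ (1 / 4 : ℝ)) + 7 / (16 * √l)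
      + √l * (2 + l))

/-- The function `m_L`. -/
def mL (l : ℝ) : ℝ := max (5 * l) (max (l * (1 + l / 2) ^ 2) (9 / l))

/-- The constant `c₁` of the lower bounds. -/
def hermiteC1 (ε τ : ℝ) : ℝ :=
  √(2 / (1 + τ ^ 2 * ε ^ 2)) * Real.exp (-(1 / 32 * τ ^ 4 * ε ^ 4 + 1 / 2 * ε ^ 2))

/-- The constant `c₂` of the upper bounds. -/
def hermiteC2 (ε τ : ℝ) : ℝ := 2 * √(cL (τ ^ 2 * ε ^ 2))

end

/-! The error functional of `A` at `x` is represented by `A.residual H x`, so the worst-case error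
is the supremum over `x` of the norm of this residual. Write l = τ²ε². For every centre c the kernel
equals w(x) w(y) exp(l (x - c)(y - c)) with a weight w depending on c. Hence the squared norm of the
residual is the sum over m of l^m / m! times the squared error at `x` on w (X - c)^m
(`LinearApprox.hasSum_norm_residual_sq`). Both bounds are read off from this series.

Lower bound, with c = 0. Let N(p) be the sum of m! l^(-m) p_m². If p vanishes at the nodes,
Cauchy–Schwarz gives p(x)² ≤ e^(ε²) N(p) ‖residual‖² (`LinearApprox.sq_eval_le`). Conversely, a
Chebyshev expansion bounds N(p) by a multiple of the squared sup norm of p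
(`sum_weighted_sq_coeff_le_of_abs_eval_le`). For the nodal polynomial the two inequalities close up:
N cancels and a lower bound on the error remains.

Upper bounds. Interpolate f / w by a polynomial, with a centre γx that moves with the point of
evaluation. The terms m < n vanish and the others are controlled because l / n ≤ 1/5. For arbitrary
nodes γ = -1, and the error on (X - c)^m is at most 2^m (m + 1 - n) (`abs_interpError_sub_pow_le`).
For Chebyshev nodes γ = 0, and the error on X^m is at most 4 u^(-n) ((u + 1/u)/2)^m for every u ≥ 1
(`abs_interpError_X_pow_le`). The remaining factors 250 and 16 e^l are absorbed by `cL`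
(`le_cL_mul`). -/

open Finset RKHS Polynomial

/-! ### Residual representers and expansions of the kernel -/

section Residual

variable (H : Type*) [NormedAddCommGroup H] [InnerProductSpace ℝ H] [RKHS ℝ H SymInterval ℝ]
  [CompleteSpace H]

/-- The representer of the pointwise error functional `f ↦ f x - (A f) x`. -/
noncomputable def LinearApprox.residual {n : ℕ} (A : LinearApprox n) (x : SymInterval) : H :=
  kerFun H x 1 - ∑ k, A.weight k x • kerFun H (A.node k) 1

variable {H}

lemma LinearApprox.inner_residual {n : ℕ} (A : LinearApprox n) (x : SymInterval) (f : H) :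
    inner ℝ (A.residual H x) f = f x - A.apply f x := by
  simp only [LinearApprox.residual, inner_sub_left, sum_inner, inner_smul_left, kerFun_inner,
    LinearApprox.apply]
  simp [mul_comm]

lemma LinearApprox.worstCaseError_le {n : ℕ} (A : LinearApprox n) {B : ℝ}
    (h : ∀ x, ‖A.residual H x‖ ≤ B) : worstCaseError H A ≤ ENNReal.ofReal B := by
  refine iSup₂_le fun f hf => ENNReal.div_le_of_le_mul (iSup_le fun x => ?_)
  change ‖f x - A.apply f x‖ₑ ≤ _
  rw [← A.inner_residual, ← ofReal_norm, ← ofReal_norm,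
    ← ENNReal.ofReal_mul ((norm_nonneg _).trans (h x))]
  refine ENNReal.ofReal_le_ofReal ((norm_inner_le_norm _ _).trans ?_)
  gcongr
  exact h x

/-- The residual itself is the extremal test function, since its own error at `x` is its squared
norm. -/
lemma LinearApprox.norm_residual_le_worstCaseError {n : ℕ} (A : LinearApprox n) (x : SymInterval) :
    ENNReal.ofReal ‖A.residual H x‖ ≤ worstCaseError H A := by
  by_cases h0 : A.residual H x = 0
  · simp [h0]
  refine le_trans ?_ (le_iSup₂ (f := fun (f : H) (_ : f ≠ 0) =>
    supNorm (fun x => f x - A.apply (⇑f) x) / ‖f‖ₑ) (A.residual H x) h0)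
  rw [ENNReal.le_div_iff_mul_le (by simp [h0]) (by simp)]
  refine le_trans ?_ (le_iSup _ x)
  change _ ≤ ‖A.residual H x x - A.apply (A.residual H x) x‖ₑ
  rw [← A.inner_residual, real_inner_self_eq_norm_sq, ← ofReal_norm, ← ofReal_norm,
    ← ENNReal.ofReal_mul (norm_nonneg _)]
  refine ENNReal.ofReal_le_ofReal ?_
  rw [Real.norm_of_nonneg (by positivity), sq]

/-- The weight of the expansion of the Hermite kernel around the centre `c`. -/
noncomputable def hermiteWeight (ε τ c x : ℝ) : ℝ :=
  Real.exp (-(1 / 2) * ε ^ 2 * x ^ 2 + τ ^ 2 * ε ^ 2 * (c * x - c ^ 2 / 2))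

/-- The exponents l(x - c)(y - c) and lxy differ by a function of `x` plus a function of `y`, which
the weights absorb. The freedom in `c` is what the upper bound for arbitrary nodes exploits. -/
lemma hasSum_analyticHermiteKernel (ε τ c : ℝ) (x y : SymInterval) :
    HasSum (fun m : ℕ => (τ ^ 2 * ε ^ 2) ^ m / m.factorial *
        ((hermiteWeight ε τ c x * ((x : ℝ) - c) ^ m) *
          (hermiteWeight ε τ c y * ((y : ℝ) - c) ^ m)))
      (analyticHermiteKernel ε τ x y) := by
  have h := (NormedSpace.expSeries_div_hasSum_exp
    (τ ^ 2 * ε ^ 2 * (((x : ℝ) - c) * ((y : ℝ) - c)))).mul_left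
      (hermiteWeight ε τ c x * hermiteWeight ε τ c y)
  rw [← Real.exp_eq_exp_ℝ] at h
  have e : hermiteWeight ε τ c x * hermiteWeight ε τ c y *
      Real.exp (τ ^ 2 * ε ^ 2 * (((x : ℝ) - c) * ((y : ℝ) - c))) =
        analyticHermiteKernel ε τ x y := by
    rw [hermiteWeight, hermiteWeight, ← Real.exp_add, ← Real.exp_add, analyticHermiteKernel]
    congr 1
    ring
  rw [e] at h
  refine h.congr_fun fun m => ?_
  rw [mul_pow _ (_ * _) m, mul_pow ((x : ℝ) - c)]
  ring

lemma hasSum_norm_sum_kerFun_sq {ε τ : ℝ} (hH : HasReproducingKernel H (analyticHermiteKernel ε τ))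
    (c : ℝ) {ι : Type*} [Fintype ι] (b : ι → ℝ) (y : ι → SymInterval) :
    HasSum (fun m : ℕ => (τ ^ 2 * ε ^ 2) ^ m / m.factorial *
        (∑ i, b i * (hermiteWeight ε τ c (y i) * ((y i : ℝ) - c) ^ m)) ^ 2)
      (‖∑ i, b i • kerFun H (y i) 1‖ ^ 2) := by
  have h : HasSum (fun m : ℕ => ∑ i, ∑ j, b i * b j * ((τ ^ 2 * ε ^ 2) ^ m / m.factorial *
        ((hermiteWeight ε τ c (y i) * ((y i : ℝ) - c) ^ m) *
          (hermiteWeight ε τ c (y j) * ((y j : ℝ) - c) ^ m))))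
      (∑ i, ∑ j, b i * b j * analyticHermiteKernel ε τ (y i) (y j)) :=
    hasSum_sum fun i _ => hasSum_sum fun j _ =>
      (hasSum_analyticHermiteKernel ε τ c (y i) (y j)).mul_left _
  convert h using 1
  · funext m
    rw [sq (∑ i, _), Fintype.sum_mul_sum, mul_sum]
    refine sum_congr rfl fun i _ => ?_
    rw [mul_sum]
    exact sum_congr rfl fun j _ => by ring
  · rw [← real_inner_self_eq_norm_sq, sum_inner]
    refine sum_congr rfl fun i _ => ?_
    rw [inner_sum]
    refine sum_congr rfl fun j _ => ?_
    rw [inner_smul_left, inner_smul_right, kerFun_inner, kerFun_apply, hH]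
    simp [mul_assoc]

lemma LinearApprox.hasSum_norm_residual_sq {ε τ : ℝ}
    (hH : HasReproducingKernel H (analyticHermiteKernel ε τ)) (c : ℝ) {n : ℕ}
    (A : LinearApprox n) (x : SymInterval) :
    HasSum (fun m : ℕ => (τ ^ 2 * ε ^ 2) ^ m / m.factorial *
        (hermiteWeight ε τ c x * ((x : ℝ) - c) ^ m - ∑ k, A.weight k x *
          (hermiteWeight ε τ c (A.node k) * ((A.node k : ℝ) - c) ^ m)) ^ 2)
      (‖A.residual H x‖ ^ 2) := by
  -- The index `none` carries the evaluation point with coefficient 1.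
  have h := hasSum_norm_sum_kerFun_sq hH c (ι := Option (Fin n))
    (fun i => i.elim 1 fun k => -A.weight k x) (fun i => i.elim x A.node)
  simpa [Fintype.sum_option, LinearApprox.residual, sub_eq_add_neg] using h

lemma analyticHermiteKernel_eq_weightedPowerSeriesKernel {ε τ : ℝ}
    (x y : SymInterval) : analyticHermiteKernel ε τ x y =
      weightedPowerSeriesKernel (fun k => ((τ * ε) ^ (2 * k))⁻¹ * (k.factorial : ℝ))
        (fun x => Real.exp (-(1 / 2) * ε ^ 2 * (x : ℝ) ^ 2)) x y := by
  rw [← (hasSum_analyticHermiteKernel ε τ 0 x y).tsum_eq, weightedPowerSeriesKernel, ← tsum_mul_left]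
  refine tsum_congr fun m => ?_
  simp only [hermiteWeight, sub_zero, mul_inv, inv_inv, pow_mul]
  ring_nf

end Residual

/-! ### Errors of polynomial interpolation on powers -/

section Interpolation

/-- The error of Lagrange interpolation of the polynomial `p` at the points `v k`. -/
noncomputable def interpError {n : ℕ} (v : Fin n → ℝ) (x : ℝ) : ℝ[X] →ₗ[ℝ] ℝ where
  toFun p := p.eval x - ∑ k, p.eval (v k) * (Lagrange.basis univ v k).eval x
  map_add' p q := by
    simp only [eval_add, add_mul, sum_add_distrib]
    ring
  map_smul' a p := by
    simp only [eval_smul, smul_eq_mul, mul_assoc, ← mul_sum, RingHom.id_apply]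
    ring

lemma interpError_apply {n : ℕ} (v : Fin n → ℝ) (x : ℝ) (p : ℝ[X]) :
    interpError v x p = p.eval x - ∑ k, p.eval (v k) * (Lagrange.basis univ v k).eval x := rfl

lemma interpError_of_degree_lt {n : ℕ} {v : Fin n → ℝ} (hv : Function.Injective v) (x : ℝ)
    {p : ℝ[X]} (hp : p.degree < n) : interpError v x p = 0 := by
  have h := Lagrange.eq_interpolate (s := univ) (v := v) hv.injOn (f := p) (by simpa using hp)
  have h2 := congrArg (eval x) h
  rw [Lagrange.interpolate_apply, eval_finsetSum] at h2
  simp only [eval_mul, eval_C] at h2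
  rw [interpError_apply, h2, sub_self]

lemma interpError_of_eval_eq_zero {n : ℕ} {v : Fin n → ℝ} (x : ℝ)
    {p : ℝ[X]} (hp : ∀ k, p.eval (v k) = 0) : interpError v x p = p.eval x := by
  simp [interpError_apply, hp]

/-- Induction on the nodes: with d = v a - c, divide (X - c)^k by X - v a and treat each power in
the quotient with the other nodes. The factor |x - v a| ≤ 2 - |d| telescopes the geometric sum of
2^i |d|^(k-1-i) to at most 2^k. Truncated subtraction makes the bound 0 when k < #s. -/
lemma exists_nodal_mul_add_eq_sub_pow {ι : Type*} [DecidableEq ι] (v : ι → ℝ) {c x : ℝ}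
    (hx : |x - c| ≤ 2) (s : Finset ι) (h : ∀ i ∈ s, |x - v i| ≤ 2 - |v i - c|) (k : ℕ) :
    ∃ Q R : ℝ[X], (X - C c) ^ k = Lagrange.nodal s v * Q + R ∧ R ∈ degreeLT ℝ #s ∧
      |(Lagrange.nodal s v * Q).eval x| ≤ 2 ^ k * ((k + 1 - #s : ℕ) : ℝ) := by
  induction s using Finset.induction_on generalizing k with
  | empty =>
    refine ⟨(X - C c) ^ k, 0, by simp, zero_mem _, ?_⟩
    simp only [Lagrange.nodal_empty, one_mul, eval_pow, eval_sub, eval_X, eval_C, card_empty,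
      Nat.sub_zero, abs_pow]
    calc |x - c| ^ k ≤ 2 ^ k * 1 := by rw [mul_one]; gcongr
      _ ≤ _ := by gcongr; simp
  | insert a s ha ih =>
    choose Q R hQR hR hQ using ih fun i hi => h i (mem_insert_of_mem hi)
    set d := v a - c with hd
    have hgeom : (X - C c : ℝ[X]) ^ k =
        (X - C (v a)) * ∑ i ∈ range k, C (d ^ (k - 1 - i)) * (X - C c) ^ i + C (d ^ k) := by
      have := (Commute.all (X - C c : ℝ[X]) (C d)).mul_geom_sum₂ k
      rw [show (X - C c - C d : ℝ[X]) = X - C (v a) by rw [hd, C_sub]; ring] at this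
      simp only [map_pow, mul_comm (C d ^ _), this]
      ring
    refine ⟨∑ i ∈ range k, C (d ^ (k - 1 - i)) * Q i,
      (X - C (v a)) * ∑ i ∈ range k, C (d ^ (k - 1 - i)) * R i + C (d ^ k), ?_, ?_, ?_⟩
    · rw [hgeom, Lagrange.nodal_insert_eq_nodal ha]
      simp only [hQR, mul_add, sum_add_distrib, mul_sum]
      rw [← add_assoc]
      congr 2
      exact sum_congr rfl fun i _ => by ring
    · rw [card_insert_of_notMem ha]
      refine add_mem ?_ ?_
      · have h1 : ∑ i ∈ range k, C (d ^ (k - 1 - i)) * R i ∈ degreeLT ℝ #s :=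
          sum_mem fun i _ => by
            rw [← smul_eq_C_mul]
            exact Submodule.smul_mem _ _ (hR i)
        rw [mem_degreeLT] at h1 ⊢
        by_cases h0 : ∑ i ∈ range k, C (d ^ (k - 1 - i)) * R i = 0
        · rw [h0, mul_zero, degree_zero]
          exact WithBot.bot_lt_coe _
        · rw [degree_mul, degree_X_sub_C, degree_eq_natDegree h0] at *
          have : (∑ i ∈ range k, C (d ^ (k - 1 - i)) * R i).natDegree < #s := by exact_mod_cast h1
          norm_cast
          omega
      · rw [mem_degreeLT]
        refine degree_C_le.trans_lt ?_
        norm_cast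
        omega
    · rw [card_insert_of_notMem ha, Lagrange.nodal_insert_eq_nodal ha, mul_assoc, mul_sum, eval_mul,
        eval_finsetSum, abs_mul, eval_sub, eval_X, eval_C, Nat.add_sub_add_right]
      have h2 : |∑ i ∈ range k, (Lagrange.nodal s v * (C (d ^ (k - 1 - i)) * Q i)).eval x| ≤
          (∑ i ∈ range k, 2 ^ i * |d| ^ (k - 1 - i)) * ((k - #s : ℕ) : ℝ) := by
        refine (abs_sum_le_sum_abs _ _).trans ?_
        rw [sum_mul]
        refine sum_le_sum fun i hi => ?_
        rw [mul_left_comm, eval_mul, eval_C, abs_mul, abs_pow]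
        calc |d| ^ (k - 1 - i) * |(Lagrange.nodal s v * Q i).eval x|
            ≤ |d| ^ (k - 1 - i) * (2 ^ i * ((k - #s : ℕ) : ℝ)) := by
              gcongr
              refine (hQ i).trans ?_
              gcongr
              rw [mem_range] at hi
              omega
          _ = _ := by ring
      calc |x - v a| * |∑ i ∈ range k, (Lagrange.nodal s v * (C (d ^ (k - 1 - i)) * Q i)).eval x|
          ≤ (2 - |d|) * ((∑ i ∈ range k, 2 ^ i * |d| ^ (k - 1 - i)) * ((k - #s : ℕ) : ℝ)) :=
            mul_le_mul (h a (mem_insert_self _ _)) h2 (abs_nonneg _)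
              ((abs_nonneg _).trans (h a (mem_insert_self _ _)))
        _ = (2 ^ k - |d| ^ k) * ((k - #s : ℕ) : ℝ) := by
            rw [← mul_assoc, (Commute.all (2 : ℝ) |d|).mul_geom_sum₂]
        _ ≤ 2 ^ k * ((k - #s : ℕ) : ℝ) := by
            gcongr
            linarith [pow_nonneg (abs_nonneg d) k]

lemma abs_interpError_sub_pow_le {n : ℕ} {v : Fin n → ℝ} (hv : Function.Injective v) {c x : ℝ}
    (hx : |x - c| ≤ 2) (h : ∀ i, |x - v i| ≤ 2 - |v i - c|) (k : ℕ) :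
    |interpError v x ((X - C c) ^ k)| ≤ 2 ^ k * ((k + 1 - n : ℕ) : ℝ) := by
  obtain ⟨Q, R, h1, h2, h3⟩ := exists_nodal_mul_add_eq_sub_pow v hx univ (fun i _ => h i) k
  rw [mem_degreeLT, card_univ, Fintype.card_fin] at h2
  rw [card_univ, Fintype.card_fin] at h3
  rw [h1, map_add, interpError_of_degree_lt hv x h2, add_zero, interpError_of_eval_eq_zero]
  · exact h3
  · intro k
    rw [eval_mul, Lagrange.eval_nodal_at_node (mem_univ k), zero_mul]

/-- Modulo T_n one has T_m ≡ -T_|2n-m|, so by descent the interpolant of T_m is 0 or ±T_j with j <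
n. -/
lemma abs_interpError_T_le {n : ℕ} (hn : 0 < n) {v : Fin n → ℝ} (hv : Function.Injective v)
    (hT : ∀ i, (Chebyshev.T ℝ n).eval (v i) = 0) {x : ℝ} (hx : |x| ≤ 1) (m : ℕ) :
    |(Chebyshev.T ℝ m).eval x - interpError v x (Chebyshev.T ℝ m)| ≤ 1 := by
  induction m using Nat.strong_induction_on with
  | _ m ih =>
    rcases lt_or_ge m n with h | h
    · rw [interpError_of_degree_lt hv x (by simpa using h), sub_zero]
      exact Chebyshev.abs_eval_T_real_le_one _ hx
    · have key : Chebyshev.T ℝ m = 2 * Chebyshev.T ℝ n * Chebyshev.T ℝ (m - n)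
          - Chebyshev.T ℝ (((2 * n - m : ℤ).natAbs : ℕ) : ℤ) := by
        rw [Chebyshev.T_mul_T, Chebyshev.T_natAbs]
        ring_nf
      have h0 : interpError v x (2 * Chebyshev.T ℝ n * Chebyshev.T ℝ (m - n)) =
          (2 * Chebyshev.T ℝ n * Chebyshev.T ℝ (m - n)).eval x :=
        interpError_of_eval_eq_zero x fun k => by simp [hT k]
      rw [key, map_sub, h0, eval_sub, sub_sub_sub_cancel_left, abs_sub_comm]
      -- For m = n the reflected index is n again, with no descent; there the interpolant is 0.
      rcases h.eq_or_lt with rfl | h'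
      · have h1 : interpError v x (Chebyshev.T ℝ n) = (Chebyshev.T ℝ n).eval x :=
          interpError_of_eval_eq_zero x hT
        rw [show (2 * n - n : ℤ).natAbs = n by omega, h1]
        simp
      · exact ih _ (by omega)

/-- A Chernoff bound for a random walk: multiplication by X averages T_(m+1) and T_(m-1), and u^m +
u^(-m) is an eigenfunction of this averaging with eigenvalue (u + 1/u)/2. At k = 0 the error is 0
for |m| < n and at most 2 otherwise. -/
lemma abs_interpError_X_pow_mul_T_le {n : ℕ} (hn : 0 < n) {v : Fin n → ℝ} (hv : Function.Injective v)
    (hT : ∀ i, (Chebyshev.T ℝ n).eval (v i) = 0) {x : ℝ} (hx : |x| ≤ 1) {u : ℝ} (hu : 1 ≤ u)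
    (k : ℕ) (m : ℤ) :
    |interpError v x (X ^ k * Chebyshev.T ℝ m)| ≤
      2 * (u ^ n)⁻¹ * (u ^ m + u ^ (-m)) * ((u + u⁻¹) / 2) ^ k := by
  have hu0 : 0 < u := one_pos.trans_le hu
  induction k generalizing m with
  | zero =>
    rw [pow_zero, one_mul, pow_zero, mul_one, ← Chebyshev.T_natAbs]
    have hum : u ^ m.natAbs ≤ u ^ m + u ^ (-m) := by
      rw [← zpow_natCast]
      rcases Int.natAbs_eq m with h | h
      · rw [← h]
        linarith [zpow_pos hu0 (-m)]
      · rw [show (m.natAbs : ℤ) = -m by omega]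
        linarith [zpow_pos hu0 m]
    rcases lt_or_ge m.natAbs n with h | h
    · rw [interpError_of_degree_lt hv x (by rw [Chebyshev.degree_T]; exact_mod_cast h), abs_zero]
      positivity
    · have h1 := abs_interpError_T_le hn hv hT hx m.natAbs
      have h2 := Chebyshev.abs_eval_T_real_le_one m.natAbs hx
      have h3 : 1 ≤ (u ^ n)⁻¹ * (u ^ m + u ^ (-m)) := by
        rw [inv_mul_eq_div, one_le_div (by positivity)]
        exact (pow_le_pow_right₀ hu h).trans hum
      rw [abs_le] at *
      constructor <;> linarith
  | succ k ih =>
    have key : X ^ (k + 1) * Chebyshev.T ℝ m =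
        (1 / 2 : ℝ) • (X ^ k * Chebyshev.T ℝ (m + 1) + X ^ k * Chebyshev.T ℝ (m - 1)) := by
      have h2 : (C (1 / 2) : ℝ[X]) * 2 = 1 := by
        rw [show (2 : ℝ[X]) = C 2 from rfl, ← C_mul]
        norm_num
      rw [smul_eq_C_mul, Chebyshev.T_add_one]
      linear_combination (-(X ^ (k + 1) * Chebyshev.T ℝ m)) * h2
    rw [key, map_smul, map_add, smul_eq_mul, abs_mul, abs_of_pos (by norm_num : (0 : ℝ) < 1 / 2)]
    have h1 := ih (m + 1)
    have h2 := ih (m - 1)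
    have h3 := abs_add_le (interpError v x (X ^ k * Chebyshev.T ℝ (m + 1)))
      (interpError v x (X ^ k * Chebyshev.T ℝ (m - 1)))
    have e : 2 * (u ^ n)⁻¹ * (u ^ m + u ^ (-m)) * ((u + u⁻¹) / 2) ^ (k + 1) = 1 / 2 *
        (2 * (u ^ n)⁻¹ * (u ^ (m + 1) + u ^ (-(m + 1))) * ((u + u⁻¹) / 2) ^ k +
          2 * (u ^ n)⁻¹ * (u ^ (m - 1) + u ^ (-(m - 1))) * ((u + u⁻¹) / 2) ^ k) := by
      rw [neg_add, neg_sub, sub_eq_add_neg, sub_eq_add_neg, zpow_add₀ hu0.ne', zpow_add₀ hu0.ne',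
        zpow_add₀ hu0.ne', zpow_add₀ hu0.ne', zpow_one, zpow_neg_one]
      ring
    rw [e]
    linarith

lemma abs_interpError_X_pow_le {n : ℕ} (hn : 0 < n) {v : Fin n → ℝ} (hv : Function.Injective v)
    (hT : ∀ i, (Chebyshev.T ℝ n).eval (v i) = 0) {x : ℝ} (hx : |x| ≤ 1) {u : ℝ} (hu : 1 ≤ u)
    (k : ℕ) : |interpError v x (X ^ k)| ≤ 4 * (u ^ n)⁻¹ * ((u + u⁻¹) / 2) ^ k := by
  have h := abs_interpError_X_pow_mul_T_le hn hv hT hx hu k 0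
  rw [Chebyshev.T_zero, mul_one, neg_zero, zpow_zero] at h
  linarith

/-- The zeros of the Chebyshev polynomial of degree `n`. -/
noncomputable def chebyshevNode (n : ℕ) (k : Fin n) : SymInterval :=
  ⟨Real.cos ((2 * (k : ℝ) + 1) * Real.pi / (2 * n)), Real.cos_mem_Icc _⟩

lemma eval_T_chebyshevNode (n : ℕ) (k : Fin n) :
    (Chebyshev.T ℝ n).eval (chebyshevNode n k : ℝ) = 0 := by
  have hn : (n : ℝ) ≠ 0 := by
    have := k.pos
    positivity
  rw [chebyshevNode, Chebyshev.T_real_cos, Real.cos_eq_zero_iff]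
  refine ⟨k, ?_⟩
  push_cast
  field_simp

lemma chebyshevNode_injective (n : ℕ) : Function.Injective (chebyshevNode n) := by
  intro i j h
  have hn : (0 : ℝ) < n := by exact_mod_cast i.pos
  have mem : ∀ k : Fin n, (2 * (k : ℝ) + 1) * Real.pi / (2 * n) ∈ Set.Icc 0 Real.pi := by
    intro k
    have hk : (k : ℝ) + 1 ≤ n := by exact_mod_cast k.isLt
    refine ⟨by positivity, ?_⟩
    rw [div_le_iff₀ (by positivity)]
    nlinarith [Real.pi_pos]
  have h1 := Real.injOn_cos (mem i) (mem j) (congrArg Subtype.val h)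
  have h2 : (i : ℝ) = j := by
    field_simp at h1
    linarith
  exact Fin.ext (by exact_mod_cast h2)

end Interpolation

/-! ### Parseval's identity for Chebyshev expansions -/

section ChebyshevExpansion

lemma exists_eq_sum_smul_T {n : ℕ} {p : ℝ[X]} (hp : p.degree ≤ n) :
    ∃ a : ℕ → ℝ, p = ∑ k ∈ range (n + 1), a k • Chebyshev.T ℝ k := by
  have hmem : p ∈ degreeLT ℝ (n + 1) := by
    rw [mem_degreeLT]
    refine hp.trans_lt ?_
    exact_mod_cast Nat.lt_succ_self n
  rw [← Sequence.span_degreeLT (Chebyshev.chebyshevTsequence ℝ) (by simp),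
    show Set.Iio (n + 1) = ↑(range (n + 1)) by simp,
    Submodule.mem_span_image_finset_iff_exists_fun'] at hmem
  obtain ⟨c, hc⟩ := hmem
  exact ⟨c, by simpa [Chebyshev.chebyshevTsequence] using hc.symm⟩

/-- The extra `a 0 ^ 2` appears because T_0 has squared norm π and the other T_k have π/2. -/
lemma integral_sq_sum_smul_T (n : ℕ) (a : ℕ → ℝ) :
    ∫ x, ((∑ k ∈ range (n + 1), a k • Chebyshev.T ℝ k).eval x) ^ 2 ∂Chebyshev.measureT =
      Real.pi / 2 * (a 0 ^ 2 + ∑ k ∈ range (n + 1), a k ^ 2) := by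
  have h1 : ∀ x : ℝ, ((∑ k ∈ range (n + 1), a k • Chebyshev.T ℝ k).eval x) ^ 2 =
      ∑ i ∈ range (n + 1), ∑ j ∈ range (n + 1),
        a i * a j * ((Chebyshev.T ℝ i).eval x * (Chebyshev.T ℝ j).eval x) := by
    intro x
    rw [eval_finsetSum, sq, sum_mul_sum]
    refine sum_congr rfl fun i _ => sum_congr rfl fun j _ => ?_
    rw [eval_smul, eval_smul, smul_eq_mul, smul_eq_mul]
    ring
  simp only [h1]
  have hint : ∀ i j : ℕ, MeasureTheory.Integrable (fun x : ℝ => a i * a j *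
      ((Chebyshev.T ℝ i).eval x * (Chebyshev.T ℝ j).eval x)) Chebyshev.measureT :=
    fun i j => Chebyshev.integrable_measureT (by fun_prop)
  rw [MeasureTheory.integral_finsetSum _ fun i _ =>
    MeasureTheory.integrable_finsetSum _ fun j _ => hint i j]
  have h2 : ∀ i ∈ range (n + 1), ∫ x, ∑ j ∈ range (n + 1), a i * a j *
      ((Chebyshev.T ℝ i).eval x * (Chebyshev.T ℝ j).eval x) ∂Chebyshev.measureT =
        Real.pi / 2 * ((if i = 0 then a 0 ^ 2 else 0) + a i ^ 2) := by
    intro i hi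
    rw [MeasureTheory.integral_finsetSum _ fun j _ => hint i j, sum_eq_single i]
    · rw [MeasureTheory.integral_const_mul]
      rcases eq_or_ne i 0 with rfl | h
      · rw [Nat.cast_zero, Chebyshev.integral_eval_T_real_mul_self_measureT_zero, if_pos rfl]
        ring
      · rw [Chebyshev.integral_T_real_mul_self_measureT_of_ne_zero h, if_neg h]
        ring
    · intro j _ hj
      rw [MeasureTheory.integral_const_mul,
        Chebyshev.integral_eval_T_real_mul_eval_T_real_measureT_of_ne hj.symm, mul_zero]
    · exact fun h => absurd hi h
  rw [sum_congr rfl h2, ← mul_sum, sum_add_distrib, sum_ite_eq' (range (n + 1)) 0]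
  simp

lemma sum_sq_le_of_abs_eval_le {n : ℕ} {a : ℕ → ℝ} {M : ℝ}
    (hM : ∀ x : ℝ, |x| ≤ 1 → |(∑ k ∈ range (n + 1), a k • Chebyshev.T ℝ k).eval x| ≤ M) :
    ∑ k ∈ range (n + 1), a k ^ 2 ≤ 2 * M ^ 2 := by
  have h := integral_sq_sum_smul_T n a
  rw [Chebyshev.integral_measureT_eq_integral_cos] at h
  have h2 : ∫ θ in (0 : ℝ)..Real.pi,
      ((∑ k ∈ range (n + 1), a k • Chebyshev.T ℝ k).eval (Real.cos θ)) ^ 2 ≤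
        ∫ θ in (0 : ℝ)..Real.pi, M ^ 2 := by
    refine intervalIntegral.integral_mono_on Real.pi_pos.le
      (Continuous.intervalIntegrable (by fun_prop) _ _) (by simp) fun θ _ => ?_
    rw [← sq_abs]
    have := hM _ (Real.abs_cos_le_one θ)
    gcongr
  rw [h, intervalIntegral.integral_const, smul_eq_mul, sub_zero] at h2
  have h3 : a 0 ^ 2 + ∑ k ∈ range (n + 1), a k ^ 2 ≤ 2 * M ^ 2 := by
    nlinarith [Real.pi_pos]
  nlinarith [sq_nonneg (a 0)]

end ChebyshevExpansion

/-! ### Coefficients of Chebyshev polynomials -/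

section ChebyshevCoeff

/-- The three-term recurrence turns into Pascal's rule for the coefficients. -/
lemma coeff_U_add_two_mul (i m : ℕ) :
    (Chebyshev.U ℝ (m + 2 * i : ℕ)).coeff m = (-1) ^ i * 2 ^ m * ((m + i).choose i : ℝ) := by
  induction i generalizing m with
  | zero =>
    have h := Chebyshev.leadingCoeff_U_natCast ℝ m
    rw [leadingCoeff, Chebyshev.natDegree_U_natCast] at h
    simpa using h
  | succ i ihi =>
    induction m with
    | zero =>
      have h := Chebyshev.U_add_two ℝ (2 * i : ℕ)
      rw [show (0 + 2 * (i + 1) : ℕ) = ((2 * i : ℕ) : ℤ) + 2 by push_cast; ring, h]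
      have h2 := ihi 0
      rw [zero_add] at h2
      rw [coeff_sub, h2, mul_assoc, show (2 : ℝ[X]) = C 2 from rfl, coeff_C_mul, coeff_X_mul_zero]
      simp [pow_succ]
    | succ m ihm =>
      have h := Chebyshev.U_add_two ℝ (m + 1 + 2 * i : ℕ)
      have h2 := ihi (m + 1)
      rw [show (m + 1 + 2 * (i + 1) : ℕ) = ((m + 1 + 2 * i : ℕ) : ℤ) + 2 by push_cast; ring, h,
        coeff_sub, h2, mul_assoc, show (2 : ℝ[X]) = C 2 from rfl, coeff_C_mul, coeff_X_mul,
        show ((m + 1 + 2 * i : ℕ) : ℤ) + 1 = (m + 2 * (i + 1) : ℕ) by push_cast; ring, ihm,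
        show m + 1 + (i + 1) = (m + 1 + i) + 1 by ring, Nat.choose_succ_succ,
        show m + (i + 1) = m + 1 + i by ring]
      push_cast
      ring

lemma coeff_T_add_two_mul_add_two (i m : ℕ) :
    (Chebyshev.T ℝ (m + 2 * (i + 1) : ℕ)).coeff m =
      (-1) ^ (i + 1) * 2 ^ m / 2 * ((m + i + 1).choose (i + 1) + (m + i).choose i) := by
  have h := congrArg (fun p => coeff p m) (Chebyshev.two_mul_T_eq_U_sub_U ℝ (m + 2 * i : ℕ))
  rw [show ((m + 2 * i : ℕ) : ℤ) + 2 = (m + 2 * (i + 1) : ℕ) by push_cast; ring] at h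
  simp only [coeff_sub, coeff_U_add_two_mul] at h
  rw [show (2 : ℝ[X]) = C 2 from rfl, coeff_C_mul] at h
  rw [show m + (i + 1) = m + i + 1 by ring] at h
  linear_combination h / 2

lemma coeff_T_self (m : ℕ) : (Chebyshev.T ℝ m).coeff m = 2 ^ (m - 1) := by
  have h := Chebyshev.leadingCoeff_T ℝ m
  rw [leadingCoeff, Chebyshev.natDegree_T] at h
  simpa using h

lemma coeff_T_of_odd (k m : ℕ) (h : Odd (k + m)) : (Chebyshev.T ℝ k).coeff m = 0 := by
  induction k using Nat.strong_induction_on generalizing m with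
  | _ k ih =>
    match k with
    | 0 =>
      rw [Nat.cast_zero, Chebyshev.T_zero, coeff_one, if_neg]
      rintro rfl
      simp at h
    | 1 =>
      rw [Nat.cast_one, Chebyshev.T_one, coeff_X, if_neg]
      rintro rfl
      exact absurd h (by decide)
    | k + 2 =>
      have h2 := Chebyshev.T_add_two ℝ k
      push_cast
      have e : Odd (k + m) := by
        rw [Nat.odd_iff] at *
        omega
      rw [h2, coeff_sub, ih k (by omega) m e, mul_assoc,
        show (2 : ℝ[X]) = C 2 from rfl, coeff_C_mul]
      cases m with
      | zero => simp
      | succ m =>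
        have h3 := ih (k + 1) (by omega) m (by rw [Nat.odd_iff] at *; omega)
        push_cast at h3
        rw [coeff_X_mul, h3]
        simp

lemma sq_coeff_T_add_two_mul_le (i m : ℕ) :
    ((Chebyshev.T ℝ (m + 2 * i : ℕ)).coeff m) ^ 2 ≤ 4 ^ m * ((m + i).choose i : ℝ) ^ 2 := by
  have h4 : (4 : ℝ) ^ m = (2 ^ m) ^ 2 := by
    rw [← pow_mul, mul_comm, pow_mul]
    norm_num
  cases i with
  | zero =>
    simp only [mul_zero, add_zero, Nat.choose_zero_right, Nat.cast_one, one_pow, mul_one]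
    rw [coeff_T_self, h4]
    gcongr
    · norm_num
    · omega
  | succ i =>
    have h : ((m + i).choose i : ℝ) ≤ ((m + i + 1).choose (i + 1) : ℝ) := by
      exact_mod_cast (Nat.choose_succ_succ (m + i) i).symm ▸ Nat.le_add_right _ _
    have h1 : ((-1 : ℝ) ^ (i + 1)) ^ 2 = 1 := by rw [← pow_mul, mul_comm, pow_mul]; simp
    rw [coeff_T_add_two_mul_add_two, mul_pow, div_pow, mul_pow, h1, one_mul, ← h4,
      show m + (i + 1) = m + i + 1 by ring]
    have h0 : (0 : ℝ) ≤ ((m + i).choose i : ℝ) := by positivity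
    rw [div_mul_eq_mul_div, div_le_iff₀ (by norm_num), mul_assoc]
    gcongr
    nlinarith

lemma factorial_sq_le (m i : ℕ) : (m + i).factorial ^ 2 ≤ m.factorial * (m + 2 * i).factorial := by
  induction i with
  | zero => simp [sq]
  | succ i ih =>
    rw [← add_assoc, show m + 2 * (i + 1) = m + 2 * i + 1 + 1 by ring, Nat.factorial_succ,
      Nat.factorial_succ, Nat.factorial_succ]
    calc ((m + i + 1) * (m + i).factorial) ^ 2
        = (m + i + 1) * (m + i + 1) * (m + i).factorial ^ 2 := by ring
      _ ≤ (m + 2 * i + 1 + 1) * (m + 2 * i + 1) * (m.factorial * (m + 2 * i).factorial) := by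
          exact Nat.mul_le_mul (Nat.mul_le_mul (by omega) (by omega)) ih
      _ = _ := by ring

/-- Log-convexity of the factorial (`factorial_sq_le`) trades the binomial coefficient for 1/i!²,
which makes the later sum over i converge exponentially. -/
lemma factorial_mul_sq_coeff_T_le (i m : ℕ) :
    (m.factorial : ℝ) * ((Chebyshev.T ℝ (m + 2 * i : ℕ)).coeff m) ^ 2 ≤
      4 ^ m * (m + 2 * i).factorial / (i.factorial : ℝ) ^ 2 := by
  have h1 : ((m + i).factorial : ℝ) ^ 2 ≤ m.factorial * (m + 2 * i).factorial := by
    exact_mod_cast factorial_sq_le m i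
  have h2 : ((m + i).choose i : ℝ) * i.factorial * m.factorial = (m + i).factorial := by
    have := Nat.choose_mul_factorial_mul_factorial (Nat.le_add_left i m)
    rw [Nat.add_sub_cancel] at this
    exact_mod_cast this
  rw [← h2] at h1
  have hm : (0 : ℝ) < m.factorial := by positivity
  have h3 : (m.factorial : ℝ) * ((m + i).choose i * i.factorial) ^ 2 ≤ (m + 2 * i).factorial := by
    refine le_of_mul_le_mul_left ?_ hm
    linarith
  rw [le_div_iff₀ (by positivity)]
  calc (m.factorial : ℝ) * ((Chebyshev.T ℝ (m + 2 * i : ℕ)).coeff m) ^ 2 * (i.factorial : ℝ) ^ 2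
      ≤ (m.factorial : ℝ) * (4 ^ m * ((m + i).choose i : ℝ) ^ 2) * (i.factorial : ℝ) ^ 2 := by
        gcongr
        exact sq_coeff_T_add_two_mul_le i m
    _ = 4 ^ m * ((m.factorial : ℝ) * ((m + i).choose i * i.factorial) ^ 2) := by ring
    _ ≤ _ := by gcongr

end ChebyshevCoeff

/-! ### Weighted coefficient norms of Chebyshev polynomials -/

section ChebyshevNorm

lemma sum_range_eq_sum_sub_two_mul {M : Type*} [AddCommMonoid M] {f : ℕ → M} (k : ℕ)
    (hf : ∀ m, Odd (k + m) → f m = 0) :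
    ∑ m ∈ range (k + 1), f m = ∑ i ∈ range (k / 2 + 1), f (k - 2 * i) := by
  symm
  refine sum_of_injOn (fun i => k - 2 * i) ?_ ?_ ?_ fun _ _ => rfl
  · intro i hi j hj hij
    simp only [coe_range, Set.mem_Iio] at hi hj hij
    omega
  · intro i hi
    simp only [coe_range, Set.mem_Iio] at hi ⊢
    omega
  · intro m hm hm'
    refine hf m ?_
    by_contra h
    rw [Nat.not_odd_iff] at h
    rw [mem_range] at hm
    refine hm' ⟨(k - m) / 2, ?_, ?_⟩
    · simp only [coe_range, Set.mem_Iio]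
      omega
    · simp only
      omega

variable {l : ℝ}

lemma weighted_sq_coeff_T_le (hl : 0 < l) {k i : ℕ} (h : 2 * i ≤ k) :
    ((k - 2 * i).factorial : ℝ) / l ^ (k - 2 * i) *
        ((Chebyshev.T ℝ k).coeff (k - 2 * i)) ^ 2 ≤
      4 ^ k * k.factorial / l ^ k * ((l ^ 2 / 16) ^ i / (i.factorial : ℝ) ^ 2) := by
  obtain ⟨m, rfl⟩ := Nat.exists_eq_add_of_le' h
  rw [Nat.add_sub_cancel]
  have h1 := factorial_mul_sq_coeff_T_le i m
  have h16 : (16 : ℝ) ^ i = 4 ^ (2 * i) := by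
    rw [pow_mul]
    norm_num
  calc (m.factorial : ℝ) / l ^ m * ((Chebyshev.T ℝ (m + 2 * i : ℕ)).coeff m) ^ 2
      = (m.factorial : ℝ) * ((Chebyshev.T ℝ (m + 2 * i : ℕ)).coeff m) ^ 2 / l ^ m := by ring
    _ ≤ 4 ^ m * (m + 2 * i).factorial / (i.factorial : ℝ) ^ 2 / l ^ m := by gcongr
    _ = _ := by
      rw [div_pow, h16, pow_add, pow_add, ← pow_mul]
      field_simp

lemma sum_weighted_sq_coeff_T_le (hl : 0 < l) (k : ℕ) :
    ∑ m ∈ range (k + 1), (m.factorial : ℝ) / l ^ m * ((Chebyshev.T ℝ k).coeff m) ^ 2 ≤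
      4 ^ k * k.factorial / l ^ k * Real.exp (l ^ 2 / 16) := by
  rw [sum_range_eq_sum_sub_two_mul k fun m hm => by rw [coeff_T_of_odd k m hm]; simp]
  calc _ ≤ ∑ i ∈ range (k / 2 + 1),
        4 ^ k * k.factorial / l ^ k * ((l ^ 2 / 16) ^ i / (i.factorial : ℝ)) := by
        refine sum_le_sum fun i hi => (weighted_sq_coeff_T_le hl
          (by rw [mem_range] at hi; omega)).trans ?_
        have : (1 : ℝ) ≤ i.factorial := by exact_mod_cast i.factorial_pos
        gcongr
        exact le_self_pow₀ this two_ne_zero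
    _ ≤ _ := by
        rw [← mul_sum]
        gcongr
        exact Real.sum_le_exp_of_nonneg (by positivity) _

/-- The leading coefficient 2^(n-1) saves a factor 4 over the general bound. This saving is needed
for the constant `hermiteC1`, so the first two coefficients are computed exactly. -/
lemma sum_weighted_sq_coeff_T_le_of_two_le (hl : 0 < l) {n : ℕ} (hn : 2 ≤ n) :
    ∑ m ∈ range (n + 1), (m.factorial : ℝ) / l ^ m * ((Chebyshev.T ℝ n).coeff m) ^ 2 ≤
      4 ^ n / 4 * n.factorial / l ^ n *
        (Real.exp (l ^ 2 / 16) + l ^ 2 / 16 / (n - 1) + (l ^ 2 / 16) ^ 2 / 2) := by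
  rw [sum_range_eq_sum_sub_two_mul n fun m hm => by rw [coeff_T_of_odd n m hm]; simp]
  have hn' : (1 : ℝ) < n := by exact_mod_cast hn
  set μ := l ^ 2 / 16 with hμ
  have hμ0 : 0 ≤ μ := by positivity
  calc _ ≤ ∑ i ∈ range (n / 2 + 1), 4 ^ n / 4 * n.factorial / l ^ n *
          (μ ^ i / (i.factorial : ℝ) + ((if i = 1 then μ / (n - 1) else 0) +
            (if i = 2 then μ ^ 2 / 2 else 0))) := by
        refine sum_le_sum fun i hi => ?_
        have hi2 : 2 * i ≤ n := by rw [mem_range] at hi; omega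
        match i with
        | 0 =>
          rw [mul_zero, Nat.sub_zero, coeff_T_self, ← pow_mul, mul_comm (n - 1) 2,
            pow_mul]
          obtain ⟨p, rfl⟩ := Nat.exists_eq_add_of_le' hn
          simp only [pow_zero, Nat.factorial_zero, Nat.cast_one, zero_ne_one, if_false]
          rw [show p + 2 - 1 = p + 1 by omega, pow_succ (4 : ℝ) (p + 1)]
          norm_num
          apply le_of_eq
          ring
        | 1 =>
          obtain ⟨p, rfl⟩ := Nat.exists_eq_add_of_le' hn
          have h1 := coeff_T_add_two_mul_add_two 0 p
          simp only [zero_add, mul_one, add_zero, Nat.choose_one_right, Nat.choose_zero_right] at h1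
          rw [mul_one, Nat.add_sub_cancel, h1, Nat.factorial_succ, Nat.factorial_succ, hμ]
          simp only [pow_one, Nat.factorial_one, if_true]
          rw [if_neg (by norm_num)]
          push_cast
          rw [show (4 : ℝ) ^ (p + 2) = (2 ^ p) ^ 2 * 16 by
            rw [← pow_mul, mul_comm p 2, pow_mul, pow_add]; norm_num]
          apply le_of_eq
          have hp : ((p : ℝ) + 2 - 1) ≠ 0 := by
            have : (0 : ℝ) ≤ p := by positivity
            linarith
          field_simp
          ring
        -- The general estimate loses a factor 4. For i = 2 it gives μ², that is μ²/2 plus the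
        -- correction μ²/2; from i = 3 on, i! ≥ 4 pays for the loss.
        | i + 2 =>
          refine (weighted_sq_coeff_T_le hl hi2).trans ?_
          rw [← hμ, if_neg (by omega), zero_add]
          have h0 : 4 ^ n * (n.factorial : ℝ) / l ^ n =
            4 ^ n / 4 * n.factorial / l ^ n * 4 := by ring
          rw [h0, mul_assoc (_ / _)]
          gcongr
          rcases Nat.eq_zero_or_pos i with rfl | hi0
          · norm_num [Nat.factorial]
            apply le_of_eq
            ring
          · rw [if_neg (by omega), add_zero]
            have h4 : (4 : ℝ) ≤ (i + 2).factorial := by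
              have : (3 : ℕ).factorial ≤ (i + 2).factorial := Nat.factorial_le (by omega)
              exact_mod_cast (by norm_num [Nat.factorial] at *; omega : 4 ≤ (i + 2).factorial)
            rw [mul_div_assoc', div_le_div_iff₀ (by positivity) (by positivity)]
            have : 0 ≤ μ ^ (i + 2) * (i + 2).factorial := by positivity
            nlinarith
    _ ≤ _ := by
        rw [← mul_sum, sum_add_distrib, sum_add_distrib, ← add_assoc]
        gcongr
        · exact Real.sum_le_exp_of_nonneg hμ0 _
        · rw [sum_ite_eq']
          split_ifs
          · exact le_rfl
          · have : 0 < (n : ℝ) - 1 := by linarith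
            positivity
        · rw [sum_ite_eq']
          split_ifs
          · exact le_rfl
          · positivity

/-- Each induction step costs (1 + 1/n)^j ≤ e < 3. -/
lemma pow_mul_factorial_sub_le {n j : ℕ} (h : j ≤ n) :
    (n : ℝ) ^ j * (n - j).factorial ≤ 3 ^ j * n.factorial := by
  induction j generalizing n with
  | zero => simp
  | succ j ih =>
    obtain ⟨n, rfl⟩ := Nat.exists_eq_add_of_le' (Nat.one_le_of_lt h)
    have hj : j ≤ n := by omega
    rw [Nat.add_sub_add_right, Nat.factorial_succ]
    rcases Nat.eq_zero_or_pos n with rfl | hn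
    · obtain rfl : j = 0 := by omega
      norm_num
    have hn0 : (0 : ℝ) < n := by exact_mod_cast hn
    have h1 : ((n : ℝ) + 1) ^ j ≤ 3 * (n : ℝ) ^ j := by
      have h2 : (1 + 1 / (n : ℝ)) ^ j ≤ 3 := by
        calc (1 + 1 / (n : ℝ)) ^ j ≤ (Real.exp (1 / n)) ^ j := by
              gcongr
              linarith [Real.add_one_le_exp (1 / (n : ℝ))]
          _ = Real.exp (j / n) := by rw [← Real.exp_nat_mul]; congr 1; ring
          _ ≤ Real.exp 1 := by
              gcongr
              rw [div_le_one hn0]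
              exact_mod_cast hj
          _ ≤ 3 := by linarith [Real.exp_one_lt_d9]
      have h3 : ((n : ℝ) + 1) = (1 + 1 / n) * n := by field_simp
      rw [h3, mul_pow]
      gcongr
    push_cast
    calc ((n : ℝ) + 1) ^ (j + 1) * (n - j).factorial
        = (n + 1) * (((n : ℝ) + 1) ^ j * (n - j).factorial) := by ring
      _ ≤ (n + 1) * (3 * (n : ℝ) ^ j * (n - j).factorial) := by gcongr
      _ = 3 * (n + 1) * ((n : ℝ) ^ j * (n - j).factorial) := by ring
      _ ≤ 3 * (n + 1) * (3 ^ j * n.factorial) :=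
        mul_le_mul_of_nonneg_left (ih hj) (by positivity)
      _ = _ := by ring

/-- Read from the top degree downwards, the sum is dominated by a geometric series of ratio r =
3l/(4n) ≤ 3/20. -/
lemma sum_four_pow_mul_factorial_div_le (hl : 0 < l) {n : ℕ} (hn : 7 ≤ n) (hln : 5 * l ≤ n) :
    ∑ k ∈ range n, 4 ^ k * (k.factorial : ℝ) / l ^ k ≤
      4 ^ n * n.factorial / l ^ n * (16 / 125 * l) := by
  have hn0 : (7 : ℝ) ≤ n := by exact_mod_cast hn
  have hnp : (0 : ℝ) < n := by linarith
  set r := 3 * l / (4 * n) with hr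
  have hr0 : 0 ≤ r := by positivity
  have hr1 : r ≤ 3 / 20 := by
    rw [hr, div_le_iff₀ (by positivity)]
    linarith
  calc ∑ k ∈ range n, 4 ^ k * (k.factorial : ℝ) / l ^ k
      = ∑ j ∈ range n, 4 ^ (n - 1 - j) * ((n - 1 - j).factorial : ℝ) / l ^ (n - 1 - j) :=
        (sum_range_reflect _ n).symm
    _ ≤ ∑ j ∈ range n, 4 ^ n * n.factorial / l ^ n * (r * r ^ j) := by
        refine sum_le_sum fun j hj => ?_
        rw [mem_range] at hj
        have h := pow_mul_factorial_sub_le (show j + 1 ≤ n by omega)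
        rw [show n - 1 - j = n - (j + 1) by omega]
        have h4 : (4 : ℝ) ^ n = 4 ^ (n - (j + 1)) * 4 ^ (j + 1) := by
          rw [← pow_add, Nat.sub_add_cancel (by omega)]
        have hl4 : l ^ n = l ^ (n - (j + 1)) * l ^ (j + 1) := by
          rw [← pow_add, Nat.sub_add_cancel (by omega)]
        rw [← pow_succ', hr, div_pow, mul_pow, mul_pow, h4, hl4]
        rw [show 4 ^ (n - (j + 1)) * 4 ^ (j + 1) * (n.factorial : ℝ) /
          (l ^ (n - (j + 1)) * l ^ (j + 1)) *
            (3 ^ (j + 1) * l ^ (j + 1) / (4 ^ (j + 1) * (n : ℝ) ^ (j + 1))) =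
          4 ^ (n - (j + 1)) * (3 ^ (j + 1) * (n.factorial : ℝ) / (n : ℝ) ^ (j + 1)) /
            l ^ (n - (j + 1)) by field_simp]
        gcongr
        rw [le_div_iff₀ (by positivity), mul_comm]
        exact h
    _ = 4 ^ n * n.factorial / l ^ n * (r * ∑ j ∈ range n, r ^ j) := by
        rw [← mul_sum, ← mul_sum]
    _ ≤ _ := by
        refine mul_le_mul_of_nonneg_left ?_ (by positivity)
        have h1 : ∑ j ∈ range n, r ^ j ≤ 20 / 17 := by
          have h2 := mul_neg_geom_sum r n
          have h3 : 0 ≤ ∑ j ∈ range n, r ^ j := sum_nonneg fun j _ => by positivity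
          have h4 := pow_nonneg hr0 n
          nlinarith
        have h5 : r ≤ 3 / 28 * l := by
          rw [hr, div_le_iff₀ (by positivity)]
          nlinarith
        calc r * ∑ j ∈ range n, r ^ j ≤ 3 / 28 * l * (20 / 17) := by gcongr
          _ ≤ _ := by linarith

/-- The degree n term supplies the 1 in 1 + l. Everything else fits into l because 4 · 16/125 + 1/60
+ 1/8 < 1. -/
lemma sum_sum_weighted_sq_coeff_T_le (hl : 0 < l) {n : ℕ} (hn : 7 ≤ n) (hln : 5 * l ≤ n) :
    ∑ k ∈ range (n + 1), ∑ m ∈ range (n + 1),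
        (m.factorial : ℝ) / l ^ m * ((Chebyshev.T ℝ k).coeff m) ^ 2 ≤
      4 ^ n / 4 * n.factorial / l ^ n * ((1 + l) * Real.exp (l ^ 2 / 16)) := by
  have hn0 : (7 : ℝ) ≤ n := by exact_mod_cast hn
  have hE : 0 < Real.exp (l ^ 2 / 16) := Real.exp_pos _
  rw [sum_range_succ]
  have h1 := sum_weighted_sq_coeff_T_le_of_two_le hl (show 2 ≤ n by omega)
  have h2 : ∑ k ∈ range n, ∑ m ∈ range (n + 1),
        (m.factorial : ℝ) / l ^ m * ((Chebyshev.T ℝ k).coeff m) ^ 2 ≤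
      4 ^ n * n.factorial / l ^ n * (16 / 125 * l) * Real.exp (l ^ 2 / 16) := by
    calc _ ≤ ∑ k ∈ range n, 4 ^ k * k.factorial / l ^ k * Real.exp (l ^ 2 / 16) := by
          refine sum_le_sum fun k hk => ?_
          refine le_trans (le_of_eq ?_) (sum_weighted_sq_coeff_T_le hl k)
          rw [mem_range] at hk
          symm
          refine sum_subset (range_subset_range.2 (by omega)) fun m _ hm => ?_
          have hkm : (Chebyshev.T ℝ k).natDegree < m := by
            rw [mem_range] at hm
            rw [Chebyshev.natDegree_T, Int.natAbs_natCast]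
            omega
          rw [coeff_eq_zero_of_natDegree_lt hkm, zero_pow two_ne_zero, mul_zero]
      _ ≤ _ := by
          rw [← sum_mul]
          gcongr
          exact sum_four_pow_mul_factorial_div_le hl hn hln
  set P := 4 ^ n / 4 * (n.factorial : ℝ) / l ^ n with hP
  have hP0 : 0 ≤ P := by positivity
  have h3 : 4 ^ n * (n.factorial : ℝ) / l ^ n = 4 * P := by rw [hP]; ring
  rw [h3] at h2
  have h4 : l ^ 2 / 16 / ((n : ℝ) - 1) ≤ l / 60 := by
    rw [div_le_iff₀ (by linarith)]
    nlinarith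
  have h5 : (l ^ 2 / 16) ^ 2 / 2 ≤ l / 8 * Real.exp (l ^ 2 / 16) := by
    have h6 := Real.quadratic_le_exp_of_nonneg (show 0 ≤ l ^ 2 / 16 by positivity)
    have h7 : l * (l ^ 2 / 16) / 32 * 8 ≤ Real.exp (l ^ 2 / 16) := by
      nlinarith [sq_nonneg (l / 4 - 1), sq_nonneg (l ^ 2 / 16), mul_nonneg hl.le
        (sq_nonneg (l / 4 - 1)), sq_nonneg (l ^ 2 / 16 - l / 4)]
    nlinarith
  have h8 : 1 ≤ Real.exp (l ^ 2 / 16) := Real.one_le_exp (by positivity)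
  have h9 : Real.exp (l ^ 2 / 16) + l ^ 2 / 16 / ((n : ℝ) - 1) + (l ^ 2 / 16) ^ 2 / 2 ≤
      (1 + l * (1 / 60 + 1 / 8)) * Real.exp (l ^ 2 / 16) := by nlinarith
  have h10 := mul_le_mul_of_nonneg_left h9 hP0
  have h11 : 0 ≤ P * l * Real.exp (l ^ 2 / 16) := by positivity
  linarith

end ChebyshevNorm

/-! ### The lower bound for arbitrary approximations -/

section LowerBound

variable {H : Type*} [NormedAddCommGroup H] [InnerProductSpace ℝ H] [RKHS ℝ H SymInterval ℝ]
  [CompleteSpace H]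

/-- The approximation of w p vanishes because p vanishes at the nodes, so w(x) p(x) is the pairing
of the coefficients of p with the errors on w X^m. Cauchy–Schwarz applies, and e^(ε²) compensates
the weight at `x`. -/
lemma LinearApprox.sq_eval_le {ε τ : ℝ} (hε : 0 < ε) (hτ : 0 < τ)
    (hH : HasReproducingKernel H (analyticHermiteKernel ε τ)) {n : ℕ} (A : LinearApprox n)
    {p : ℝ[X]} {N : ℕ} (hp : p.natDegree < N) (h0 : ∀ k, p.eval (A.node k : ℝ) = 0)
    (x : SymInterval) :
    (p.eval (x : ℝ)) ^ 2 ≤ Real.exp (ε ^ 2) *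
      (∑ m ∈ range N, (m.factorial : ℝ) / (τ ^ 2 * ε ^ 2) ^ m * p.coeff m ^ 2) *
        ‖A.residual H x‖ ^ 2 := by
  set l := τ ^ 2 * ε ^ 2 with hl
  have hl0 : 0 < l := by positivity
  set w := hermiteWeight ε τ 0 with hw
  have hsum := A.hasSum_norm_residual_sq hH 0 x
  rw [← hl, ← hw] at hsum
  simp only [sub_zero] at hsum
  set g : ℕ → ℝ := fun m => w x * (x : ℝ) ^ m -
    ∑ k, A.weight k x * (w (A.node k) * (A.node k : ℝ) ^ m) with hg
  have h1 : ∑ m ∈ range N, l ^ m / m.factorial * g m ^ 2 ≤ ‖A.residual H x‖ ^ 2 :=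
    sum_le_hasSum _ (fun m _ => by positivity) hsum
  have hev : ∀ y : ℝ, ∑ m ∈ range N, p.coeff m * y ^ m = p.eval y := fun y =>
    (eval_eq_sum_range' hp y).symm
  have h2 : ∑ m ∈ range N, p.coeff m * g m = w x * p.eval (x : ℝ) := by
    simp only [hg, mul_sub, sum_sub_distrib, mul_sum]
    rw [sum_comm]
    have h3 : ∀ k, ∑ m ∈ range N, p.coeff m *
        (A.weight k x * (w (A.node k) * (A.node k : ℝ) ^ m)) = 0 := by
      intro k
      rw [← mul_zero (A.weight k x * w (A.node k)), ← h0 k, ← hev, mul_sum]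
      exact sum_congr rfl fun m _ => by ring
    simp only [h3, sum_const_zero, sub_zero]
    rw [← hev, mul_sum]
    exact sum_congr rfl fun m _ => by ring
  have h4 : (w x * p.eval (x : ℝ)) ^ 2 ≤
      (∑ m ∈ range N, (m.factorial : ℝ) / l ^ m * p.coeff m ^ 2) *
        ∑ m ∈ range N, l ^ m / m.factorial * g m ^ 2 := by
    rw [← h2]
    refine sum_sq_le_sum_mul_sum_of_sq_le_mul _ (fun m _ => by positivity)
      (fun m _ => by positivity) fun m _ => le_of_eq ?_
    field_simp
  have hx : (x : ℝ) ^ 2 ≤ 1 := by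
    rw [sq_le_one_iff_abs_le_one, abs_le]
    exact x.2
  have h5 : 1 ≤ Real.exp (ε ^ 2) * w x ^ 2 := by
    rw [hw, hermiteWeight, ← Real.exp_nat_mul, ← Real.exp_add]
    refine Real.one_le_exp ?_
    push_cast
    nlinarith [mul_nonneg (sq_nonneg ε) (sub_nonneg.2 hx)]
  calc (p.eval (x : ℝ)) ^ 2 ≤ (Real.exp (ε ^ 2) * w x ^ 2) * (p.eval (x : ℝ)) ^ 2 :=
        le_mul_of_one_le_left (sq_nonneg _) h5
    _ = Real.exp (ε ^ 2) * (w x * p.eval (x : ℝ)) ^ 2 := by ring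
    _ ≤ Real.exp (ε ^ 2) * ((∑ m ∈ range N, (m.factorial : ℝ) / l ^ m * p.coeff m ^ 2) *
        ‖A.residual H x‖ ^ 2) := by
      gcongr
      refine h4.trans ?_
      gcongr
    _ = _ := by ring

lemma sum_weighted_sq_coeff_le {l : ℝ} (hl : 0 < l) (n : ℕ) (a : ℕ → ℝ) :
    ∑ m ∈ range (n + 1), (m.factorial : ℝ) / l ^ m *
        (∑ k ∈ range (n + 1), a k • Chebyshev.T ℝ k).coeff m ^ 2 ≤
      (∑ k ∈ range (n + 1), a k ^ 2) * ∑ k ∈ range (n + 1), ∑ m ∈ range (n + 1),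
        (m.factorial : ℝ) / l ^ m * ((Chebyshev.T ℝ k).coeff m) ^ 2 := by
  rw [sum_comm (s := range (n + 1)) (t := range (n + 1)), mul_sum]
  refine sum_le_sum fun m _ => ?_
  rw [← mul_sum, mul_left_comm]
  gcongr
  simp only [finsetSum_coeff, coeff_smul, smul_eq_mul]
  exact sum_mul_sq_le_sq_mul_sq _ _ _

/-- A polynomial that is bounded on `[-1, 1]` has a bounded norm in the Hermite space. -/
lemma sum_weighted_sq_coeff_le_of_abs_eval_le {l : ℝ} (hl : 0 < l) {n : ℕ} (hn : 7 ≤ n)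
    (hln : 5 * l ≤ n) {p : ℝ[X]} (hp : p.natDegree ≤ n) {M : ℝ}
    (hM : ∀ x : ℝ, |x| ≤ 1 → |p.eval x| ≤ M) :
    ∑ m ∈ range (n + 1), (m.factorial : ℝ) / l ^ m * p.coeff m ^ 2 ≤
      2 * M ^ 2 * (4 ^ n / 4 * n.factorial / l ^ n * ((1 + l) * Real.exp (l ^ 2 / 16))) := by
  obtain ⟨a, rfl⟩ := exists_eq_sum_smul_T (natDegree_le_iff_degree_le.1 hp)
  exact (sum_weighted_sq_coeff_le hl n a).trans (mul_le_mul (sum_sq_le_of_abs_eval_le hM)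
    (sum_sum_weighted_sq_coeff_T_le hl hn hln)
    (sum_nonneg fun k _ => sum_nonneg fun m _ => by positivity) (by positivity))

/-- The norm N of the nodal polynomial bounds its sup norm through the residual, and the sup norm
bounds N. Division by N > 0 removes all dependence on the nodes. -/
lemma LinearApprox.one_le_mul_sq {ε τ : ℝ} (hε : 0 < ε) (hτ : 0 < τ)
    (hH : HasReproducingKernel H (analyticHermiteKernel ε τ)) {n : ℕ} (hn : 7 ≤ n)
    (hln : 5 * (τ ^ 2 * ε ^ 2) ≤ n) (A : LinearApprox n) {E : ℝ}
    (h : ∀ x, ‖A.residual H x‖ ≤ E) :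
    1 ≤ 2 * (Real.exp (ε ^ 2) * E ^ 2) * (4 ^ n / 4 * n.factorial / (τ ^ 2 * ε ^ 2) ^ n *
      ((1 + τ ^ 2 * ε ^ 2) * Real.exp ((τ ^ 2 * ε ^ 2) ^ 2 / 16))) := by
  obtain ⟨W, hdeg, hmonic, hroot⟩ : ∃ W : ℝ[X], W.natDegree = n ∧ W.Monic ∧
      ∀ k, W.eval (A.node k : ℝ) = 0 :=
    ⟨Lagrange.nodal univ fun k => (A.node k : ℝ), by simp [Lagrange.natDegree_nodal],
      Lagrange.nodal_monic,
      fun k => Lagrange.eval_nodal_at_node (v := fun k => (A.node k : ℝ)) (mem_univ k)⟩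
  have hmain := fun x => A.sq_eval_le hε hτ hH (p := W) (N := n + 1) (by omega) hroot x
  have hbound := @sum_weighted_sq_coeff_le_of_abs_eval_le _ (by positivity) n hn hln W hdeg.le
  have hl0 : 0 < τ ^ 2 * ε ^ 2 := by positivity
  generalize τ ^ 2 * ε ^ 2 = l at *
  have hNpos : 0 < ∑ m ∈ range (n + 1), (m.factorial : ℝ) / l ^ m * W.coeff m ^ 2 := by
    refine sum_pos' (fun m _ => by positivity) ⟨n, self_mem_range_succ n, ?_⟩
    rw [Monic, leadingCoeff, hdeg] at hmonic
    rw [hmonic]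
    positivity
  generalize ∑ m ∈ range (n + 1), (m.factorial : ℝ) / l ^ m * W.coeff m ^ 2 = N at *
  have h1 := @hbound (√(Real.exp (ε ^ 2) * N * E ^ 2)) fun x hx => by
    refine Real.abs_le_sqrt ((hmain ⟨x, abs_le.1 hx⟩).trans ?_)
    gcongr
    exact h _
  rw [Real.sq_sqrt (by positivity)] at h1
  refine le_of_mul_le_mul_left ((mul_one _).trans_le (h1.trans_eq ?_)) hNpos
  ring

lemma LinearApprox.lower_bound {ε τ : ℝ} (hε : 0 < ε) (hτ : 0 < τ)
    (hH : HasReproducingKernel H (analyticHermiteKernel ε τ)) {n : ℕ} (hn : 7 ≤ n)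
    (hln : 5 * (τ ^ 2 * ε ^ 2) ≤ n) (A : LinearApprox n) {E : ℝ} (hE : 0 ≤ E)
    (h : ∀ x, ‖A.residual H x‖ ≤ E) :
    hermiteC1 ε τ * (τ * ε / 2) ^ n * (n.factorial : ℝ) ^ (-(1 / 2) : ℝ) ≤ E := by
  have h5 := A.one_le_mul_sq hε hτ hH hn hln h
  set l := τ ^ 2 * ε ^ 2 with hl
  have hl0 : 0 < l := by positivity
  set R := 4 ^ n / 4 * (n.factorial : ℝ) / l ^ n * ((1 + l) * Real.exp (l ^ 2 / 16)) with hR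
  have hc : 0 ≤ hermiteC1 ε τ := by
    rw [hermiteC1]
    positivity
  refine (pow_le_pow_iff_left₀ (by positivity) hE two_ne_zero).1 ?_
  -- The constant `hermiteC1` is exactly the one that makes this product equal to 1.
  have h6 : (hermiteC1 ε τ * (τ * ε / 2) ^ n * (n.factorial : ℝ) ^ (-(1 / 2) : ℝ)) ^ 2 *
      (2 * Real.exp (ε ^ 2) * R) = 1 := by
    have e1 : (hermiteC1 ε τ) ^ 2 = 2 / (1 + l) * Real.exp (-(l ^ 2 / 16 + ε ^ 2)) := by
      rw [hermiteC1, mul_pow, Real.sq_sqrt (by positivity), ← Real.exp_nat_mul, hl]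
      congr 2
      push_cast
      ring
    have e2 : ((n.factorial : ℝ) ^ (-(1 / 2) : ℝ)) ^ 2 = (n.factorial : ℝ)⁻¹ := by
      rw [← Real.rpow_natCast, ← Real.rpow_mul (by positivity)]
      norm_num [Real.rpow_neg_one]
    have e3 : ((τ * ε / 2) ^ n) ^ 2 = l ^ n / 4 ^ n := by
      rw [← pow_mul, mul_comm n 2, pow_mul, ← div_pow, hl]
      congr 1
      ring
    rw [mul_pow, mul_pow, e1, e2, e3, hR, neg_add, Real.exp_add, Real.exp_neg, Real.exp_neg]
    field_simp
    norm_num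
  have h7 : 0 < 2 * Real.exp (ε ^ 2) * R := by positivity
  refine le_of_mul_le_mul_right ?_ h7
  rw [h6]
  linarith

lemma LinearApprox.lower_bound_worstCaseError {ε τ : ℝ} (hε : 0 < ε) (hτ : 0 < τ)
    (hH : HasReproducingKernel H (analyticHermiteKernel ε τ)) {n : ℕ} (hn : 7 ≤ n)
    (hln : 5 * (τ ^ 2 * ε ^ 2) ≤ n) (A : LinearApprox n) :
    ENNReal.ofReal (hermiteC1 ε τ * (τ * ε / 2) ^ n * (n.factorial : ℝ) ^ (-(1 / 2) : ℝ)) ≤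
      worstCaseError H A := by
  by_cases htop : worstCaseError H A = ⊤
  · rw [htop]
    exact le_top
  refine ENNReal.ofReal_le_of_le_toReal
    (A.lower_bound hε hτ hH hn hln ENNReal.toReal_nonneg fun x => ?_)
  exact (ENNReal.ofReal_le_iff_le_toReal htop).1 (A.norm_residual_le_worstCaseError x)

end LowerBound

/-! ### Upper bounds by weighted interpolation -/

section UpperBound

variable {H : Type*} [NormedAddCommGroup H] [InnerProductSpace ℝ H] [RKHS ℝ H SymInterval ℝ]
  [CompleteSpace H]

/-- Lagrange interpolation of `f / w`, multiplied by `w`, where `w` is the weight of the expansion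
of the Hermite kernel around the centre `γ x` that moves with the point of evaluation `x`. -/
noncomputable def weightedInterpolation (ε τ γ : ℝ) {n : ℕ} (node : Fin n → SymInterval)
    (hnode : Function.Injective node) : LinearApprox n where
  node := node
  node_injective := hnode
  weight k x := hermiteWeight ε τ (γ * x) x / hermiteWeight ε τ (γ * x) (node k) *
    (Lagrange.basis univ (fun i => (node i : ℝ)) k).eval (x : ℝ)
  weight_measurable k := by
    refine Measurable.nullMeasurable (Continuous.measurable ?_)
    unfold hermiteWeight
    refine Continuous.mul (Continuous.div (by fun_prop) (by fun_prop)
      fun x => (Real.exp_pos _).ne') ?_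
    exact (Polynomial.continuous _).comp continuous_subtype_val

lemma hasSum_norm_residual_weightedInterpolation_sq {ε τ : ℝ}
    (hH : HasReproducingKernel H (analyticHermiteKernel ε τ)) (γ : ℝ) {n : ℕ}
    {node : Fin n → SymInterval} (hnode : Function.Injective node) (x : SymInterval) :
    HasSum (fun m : ℕ => (τ ^ 2 * ε ^ 2) ^ m / m.factorial * (hermiteWeight ε τ (γ * x) x *
        interpError (fun k => (node k : ℝ)) x ((X - C (γ * x)) ^ m)) ^ 2)
      (‖(weightedInterpolation ε τ γ node hnode).residual H x‖ ^ 2) := by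
  refine ((weightedInterpolation ε τ γ node hnode).hasSum_norm_residual_sq hH
    (γ * x) x).congr_fun fun m => ?_
  congr 2
  rw [interpError_apply, mul_sub, mul_sum]
  simp only [eval_pow, eval_sub, eval_X, eval_C, weightedInterpolation]
  congr 1
  refine sum_congr rfl fun k _ => ?_
  have : hermiteWeight ε τ (γ * x) (node k) ≠ 0 := (Real.exp_pos _).ne'
  field_simp

/-- From (n + j)! ≥ n! n^j, the tail of the exponential series becomes a power series in l / n. -/
lemma hasSum_le_of_sq_le {l : ℝ} (hl : 0 ≤ l) {n : ℕ} (hn : 0 < n) {e h : ℕ → ℝ} {G N S : ℝ}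
    (he0 : ∀ m < n, e m = 0) (he : ∀ j, e (n + j) ^ 2 ≤ G * h j)
    (hS : HasSum (fun j => (l / n) ^ j * h j) S)
    (hN : HasSum (fun m : ℕ => l ^ m / m.factorial * e m ^ 2) N) :
    N ≤ l ^ n / n.factorial * (G * S) := by
  have h1 : HasSum (fun j : ℕ => l ^ (j + n) / (j + n).factorial * e (j + n) ^ 2) N := by
    have h2 := (hasSum_nat_add_iff' n).2 hN
    rwa [sum_eq_zero, sub_zero] at h2
    intro m hm
    rw [he0 m (mem_range.1 hm)]
    simp
  refine hasSum_le (fun j => ?_) h1 ((hS.mul_left G).mul_left _)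
  have hn' : (0 : ℝ) < n := by exact_mod_cast hn
  have h3 : (n.factorial : ℝ) * (n : ℝ) ^ j ≤ (j + n).factorial := by
    rw [add_comm]
    exact_mod_cast (Nat.mul_le_mul_left _ (Nat.pow_le_pow_left n.le_succ j)).trans
      Nat.factorial_mul_pow_le_factorial
  calc l ^ (j + n) / (j + n).factorial * e (j + n) ^ 2
      ≤ l ^ (j + n) / (n.factorial * (n : ℝ) ^ j) * (G * h j) := by
        have := he j
        rw [add_comm n j] at this
        gcongr
    _ = _ := by
        rw [pow_add, div_pow]
        field_simp

lemma hermiteWeight_sq_le_one {ε τ γ x : ℝ} (hγ : γ ≤ γ ^ 2 / 2) :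
    hermiteWeight ε τ (γ * x) x ^ 2 ≤ 1 := by
  rw [hermiteWeight, ← Real.exp_nat_mul, Real.exp_le_one_iff]
  push_cast
  nlinarith [mul_nonneg (sq_nonneg (τ * ε * x)) (sub_nonneg.2 hγ), sq_nonneg (ε * x)]

lemma norm_residual_weightedInterpolation_sq_le {ε τ : ℝ}
    (hH : HasReproducingKernel H (analyticHermiteKernel ε τ)) {γ : ℝ} (hγ : γ ≤ γ ^ 2 / 2)
    {n : ℕ} (hn : 0 < n) {node : Fin n → SymInterval} (hnode : Function.Injective node)
    (x : SymInterval) {h : ℕ → ℝ} {G S : ℝ}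
    (he : ∀ j, interpError (fun k => (node k : ℝ)) x ((X - C (γ * x)) ^ (n + j)) ^ 2 ≤ G * h j)
    (hS : HasSum (fun j => (τ ^ 2 * ε ^ 2 / n) ^ j * h j) S) :
    ‖(weightedInterpolation ε τ γ node hnode).residual H x‖ ^ 2 ≤
      (τ ^ 2 * ε ^ 2) ^ n / n.factorial * (G * S) := by
  refine hasSum_le_of_sq_le (by positivity) hn (fun m hm => ?_) (fun j => ?_) hS
    (hasSum_norm_residual_weightedInterpolation_sq hH γ hnode x)
  · rw [interpError_of_degree_lt, mul_zero]
    · exact fun i j hij => hnode (Subtype.ext hij)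
    · rw [degree_pow, degree_X_sub_C]
      simpa using hm
  · rw [mul_pow]
    exact (mul_le_of_le_one_left (sq_nonneg _) (hermiteWeight_sq_le_one hγ)).trans (he j)

/-- The centre -x is chosen because |x - v| + |v + x| = 2 max(|x|, |v|) ≤ 2 for every node v, which
is the hypothesis of `abs_interpError_sub_pow_le`. -/
lemma norm_residual_sq_le_of_injective {ε τ : ℝ}
    (hH : HasReproducingKernel H (analyticHermiteKernel ε τ)) {n : ℕ} (hn : 0 < n)
    (hln : 5 * (τ ^ 2 * ε ^ 2) ≤ n) {node : Fin n → SymInterval}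
    (hnode : Function.Injective node) (x : SymInterval) :
    ‖(weightedInterpolation ε τ (-1) node hnode).residual H x‖ ^ 2 ≤
      (τ ^ 2 * ε ^ 2) ^ n / n.factorial * (4 ^ n * 250) := by
  have hn' : (0 : ℝ) < n := by exact_mod_cast hn
  set l := τ ^ 2 * ε ^ 2 with hl
  have hl0 : 0 ≤ l := by positivity
  set y := 4 * (l / n) with hy
  have hy0 : 0 ≤ y := by positivity
  have hy1 : y ≤ 4 / 5 := by
    rw [hy, mul_div_assoc', div_le_div_iff₀ hn' (by norm_num)]
    linarith
  -- The majorant (j + 1)² ≤ (j + 2)(j + 1) has the closed sum 2/(1 - y)³ ≤ 250.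
  have hS : HasSum (fun j : ℕ => (l / n) ^ j * (2 * ((j + 2).choose 2 : ℝ) * 4 ^ j))
      (2 * (1 / (1 - y) ^ (2 + 1))) := by
    refine ((hasSum_choose_mul_geometric_of_norm_lt_one 2 (r := y) ?_).mul_left 2).congr_fun
      fun j => ?_
    · rw [Real.norm_of_nonneg hy0]
      linarith
    · rw [hy, mul_pow]
      ring
  refine (norm_residual_weightedInterpolation_sq_le hH (by norm_num) hn hnode x
    (G := 4 ^ n) (fun j => ?_) hS).trans ?_
  · have hx := x.2
    have h1 := abs_interpError_sub_pow_le (v := fun k => (node k : ℝ))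
      (fun i j hij => hnode (Subtype.ext hij)) (c := -1 * x) (x := x) (by
        rw [abs_le]
        constructor <;> linarith [hx.1, hx.2]) (fun i => by
        have hi := (node i).2
        rw [le_sub_iff_add_le]
        rcases abs_cases ((x : ℝ) - node i) with h | h <;>
        rcases abs_cases ((node i : ℝ) - -1 * x) with h' | h' <;>
        linarith [hx.1, hx.2, hi.1, hi.2]) (n + j)
    have h2 : ((j : ℝ) + 1) ^ 2 ≤ 2 * ((j + 2).choose 2 : ℝ) := by
      rw [Nat.cast_choose_two]
      push_cast
      nlinarith [(Nat.cast_nonneg j : (0 : ℝ) ≤ j)]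
    rw [show n + j + 1 - n = j + 1 by omega] at h1
    calc _ ≤ (2 ^ (n + j) * ((j + 1 : ℕ) : ℝ)) ^ 2 := by
          rw [← sq_abs]
          gcongr
      _ = 4 ^ n * (((j : ℝ) + 1) ^ 2 * 4 ^ j) := by
          rw [mul_pow, ← pow_mul, mul_comm (n + j) 2, pow_mul, pow_add]
          push_cast
          norm_num
          ring
      _ ≤ _ := by gcongr
  · gcongr
    have h3 : (1 / 5 : ℝ) ^ 3 ≤ (1 - y) ^ (2 + 1) := by
      gcongr
      linarith
    have h4 : (0 : ℝ) < (1 - y) ^ (2 + 1) := lt_of_lt_of_le (by norm_num) h3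
    rw [mul_one_div, div_le_iff₀ h4]
    norm_num at h3 ⊢
    linarith

lemma norm_residual_chebyshevNode_sq_le {ε τ : ℝ} (hε : 0 < ε) (hτ : 0 < τ)
    (hH : HasReproducingKernel H (analyticHermiteKernel ε τ)) {n : ℕ} (hn : 0 < n)
    (hln : 5 * (τ ^ 2 * ε ^ 2) ≤ n) (x : SymInterval) :
    ‖(weightedInterpolation ε τ 0 _ (chebyshevNode_injective n)).residual H x‖ ^ 2 ≤
      (τ ^ 2 * ε ^ 2) ^ n / n.factorial * (64 * Real.exp (τ ^ 2 * ε ^ 2) / 4 ^ n) := by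
  have hn' : (0 : ℝ) < n := by exact_mod_cast hn
  set l := τ ^ 2 * ε ^ 2 with hl
  have hl0 : 0 < l := by positivity
  -- This u makes the series in j geometric with ratio (1 + y)²/2, y = u^(-2), and leaves (1 +
  -- y)^(2n) ≤ e^l.
  set u := √(2 * n / l) with hu
  have hu2 : u ^ 2 = 2 * n / l := Real.sq_sqrt (by positivity)
  have hu0 : 0 < u := Real.sqrt_pos.2 (by positivity)
  have hu1 : 1 ≤ u := by
    rw [hu, Real.one_le_sqrt, le_div_iff₀ hl0]
    linarith
  set y := l / (2 * n) with hy
  have hy0 : 0 ≤ y := by positivity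
  have hy1 : y ≤ 1 / 10 := by
    rw [hy, div_le_iff₀ (by positivity)]
    linarith
  have hus : ((u + u⁻¹) / 2) ^ 2 = u ^ 2 * (1 + y) ^ 2 / 4 := by
    have : y = (u ^ 2)⁻¹ := by rw [hu2, hy, inv_div]
    rw [this]
    field_simp
    norm_num
  set ρ := (1 + y) ^ 2 / 2 with hρ
  have hρ1 : ρ ≤ 61 / 100 := by
    rw [hρ]
    nlinarith
  have hρ0 : 0 ≤ ρ := by positivity
  have hS : HasSum (fun j : ℕ => (l / n) ^ j * (((u + u⁻¹) / 2) ^ 2) ^ j) (1 - ρ)⁻¹ := by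
    refine (hasSum_geometric_of_lt_one hρ0 (by linarith)).congr_fun fun j => ?_
    rw [← mul_pow, hus, hu2, hρ]
    congr 1
    field_simp
    norm_num
  have hx : |(x : ℝ)| ≤ 1 := abs_le.2 x.2
  refine (norm_residual_weightedInterpolation_sq_le hH (by norm_num) hn
    (chebyshevNode_injective n) x (G := 16 * (1 + y) ^ (2 * n) / 4 ^ n)
    (fun j => ?_) hS).trans ?_
  · have h1 := abs_interpError_X_pow_le hn (v := fun k => (chebyshevNode n k : ℝ))
      (fun i j hij => chebyshevNode_injective n (Subtype.ext hij))
      (eval_T_chebyshevNode n) hx hu1 (n + j)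
    rw [zero_mul, C_0, sub_zero]
    calc _ ≤ (4 * (u ^ n)⁻¹ * ((u + u⁻¹) / 2) ^ (n + j)) ^ 2 := by
          rw [← sq_abs]
          gcongr
      _ = 16 * ((u ^ 2) ^ n)⁻¹ * (((u + u⁻¹) / 2) ^ 2) ^ n * (((u + u⁻¹) / 2) ^ 2) ^ j := by
          rw [pow_add]
          simp only [← pow_mul, mul_comm 2, mul_pow, inv_pow]
          ring
      _ = 16 * (1 + y) ^ (2 * n) / 4 ^ n * (((u + u⁻¹) / 2) ^ 2) ^ j := by
          congr 1
          rw [hus, div_pow, mul_pow, ← pow_mul (1 + y)]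
          field_simp
      _ ≤ _ := le_rfl
  · refine mul_le_mul_of_nonneg_left ?_ (by positivity)
    have h1 : (1 - ρ)⁻¹ ≤ 4 := by
      rw [inv_le_comm₀ (by linarith) (by norm_num)]
      linarith
    have h2 : (1 + y) ^ (2 * n) ≤ Real.exp l := by
      calc (1 + y) ^ (2 * n) ≤ (Real.exp y) ^ (2 * n) := by
            gcongr
            linarith [Real.add_one_le_exp y]
        _ = Real.exp l := by
            rw [← Real.exp_nat_mul, hy]
            congr 1
            push_cast
            field_simp
    calc 16 * (1 + y) ^ (2 * n) / 4 ^ n * (1 - ρ)⁻¹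
        ≤ 16 * Real.exp l / 4 ^ n * 4 := by
          have : 0 ≤ (1 - ρ)⁻¹ := inv_nonneg.2 (by linarith)
          gcongr
      _ = _ := by ring

end UpperBound

/-! ### Numerical estimates for the constants -/

section Constants

lemma exp_le_cL_mul {l : ℝ} (hl : 0 < l) {n : ℕ} (hn : 0 < n) :
    4 / 5 * Real.exp (6 + (11 / 6 * (√(l * n) - 3) - 3 / 2 * l + 2 * √l)) ≤
      cL l * (n : ℝ) ^ (-(1 / 4) : ℝ) * Real.exp (2 * √(l * n)) := by
  have hn' : (0 : ℝ) < n := by exact_mod_cast hn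
  set s := √(l * n) with hs
  have hs0 : 0 < s := Real.sqrt_pos.2 (by positivity)
  set t := √l with ht
  have ht0 : 0 < t := Real.sqrt_pos.2 hl
  have hss : √s = l ^ (1 / 4 : ℝ) * (n : ℝ) ^ (1 / 4 : ℝ) := by
    rw [hs, Real.sqrt_eq_rpow, Real.sqrt_eq_rpow, ← Real.rpow_mul (by positivity),
      Real.mul_rpow hl.le hn'.le]
    norm_num
  have hP : 5 ≤ 3 + √(Real.pi / Real.exp 1) + 2 / (√Real.pi * l ^ (1 / 4 : ℝ)) + 7 / (16 * t)
      + t * (2 + l) := by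
    have h1 : 1 ≤ √(Real.pi / Real.exp 1) := by
      rw [Real.one_le_sqrt, one_le_div (Real.exp_pos _)]
      linarith [Real.exp_one_lt_d9, Real.pi_gt_d2]
    have h2 : 0 ≤ 2 / (√Real.pi * l ^ (1 / 4 : ℝ)) := by positivity
    have h3 : 1 ≤ 7 / (16 * t) + 2 * t := by
      have : 7 / (16 * t) + 2 * t - 1 = (2 * (t - 1 / 4) ^ 2 + 5 / 16) / t := by
        field_simp
        ring
      have : 0 ≤ (2 * (t - 1 / 4) ^ 2 + 5 / 16) / t := by positivity
      linarith
    nlinarith [mul_pos ht0 hl]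
  have hpi : 2 * √Real.pi ≤ 71 / 20 := by
    have : √Real.pi ≤ 71 / 40 := by
      rw [Real.sqrt_le_left (by norm_num)]
      linarith [Real.pi_lt_d2]
    linarith
  -- After squaring, this is the tangent line of the exponential at s = 3, with 49/16 ≥ 3.
  have hsq : √s ≤ 7 / 4 * Real.exp ((s - 3) / 6) := by
    rw [Real.sqrt_le_left (by positivity), mul_pow, ← Real.exp_nat_mul]
    have h1 := Real.add_one_le_exp ((s - 3) / 3)
    have h2 : Real.exp (((2 : ℕ) : ℝ) * ((s - 3) / 6)) = Real.exp ((s - 3) / 3) := by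
      congr 1
      push_cast
      ring
    rw [h2]
    linarith
  have hcL : cL l * (n : ℝ) ^ (-(1 / 4) : ℝ) * Real.exp (2 * s) =
      Real.exp (-(3 / 2) * l + 2 * t) * Real.exp (2 * s) / (2 * √Real.pi * √s) *
        (3 + √(Real.pi / Real.exp 1) + 2 / (√Real.pi * l ^ (1 / 4 : ℝ)) + 7 / (16 * t)
      + t * (2 + l)) := by
    rw [cL, hss, Real.rpow_neg hn'.le]
    have h1 : (0 : ℝ) < (n : ℝ) ^ (1 / 4 : ℝ) := by positivity
    have h2 : (0 : ℝ) < l ^ (1 / 4 : ℝ) := by positivity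
    rw [← ht]
    generalize (3 + √(Real.pi / Real.exp 1) + 2 / (√Real.pi * l ^ (1 / 4 : ℝ)) + 7 / (16 * t)
      + t * (2 + l)) = P
    have h3 : (0 : ℝ) < √Real.pi := Real.sqrt_pos.2 Real.pi_pos
    field_simp
  rw [hcL]
  have hE : Real.exp (6 + (11 / 6 * (s - 3) - 3 / 2 * l + 2 * t)) *
      Real.exp ((s - 3) / 6) = Real.exp (-(3 / 2) * l + 2 * t) * Real.exp (2 * s) := by
    rw [← Real.exp_add, ← Real.exp_add]
    congr 1
    ring
  rw [← hE]
  have hs1 : 0 < √s := Real.sqrt_pos.2 hs0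
  have hpi0 : 0 < √Real.pi := Real.sqrt_pos.2 Real.pi_pos
  set F := Real.exp (6 + (11 / 6 * (s - 3) - 3 / 2 * l + 2 * t)) with hF
  have hF0 : 0 < F := Real.exp_pos _
  set B := Real.exp ((s - 3) / 6) with hB
  have hB0 : 0 < B := Real.exp_pos _
  calc 4 / 5 * F ≤ F * B / (71 / 20 * (7 / 4 * B)) * 5 := by
        rw [show F * B / (71 / 20 * (7 / 4 * B)) * 5 = 400 / 497 * F by field_simp; norm_num]
        linarith
    _ ≤ _ := by gcongr

lemma exponent_nonneg {l s : ℝ} (hl : 0 < l) (hs : 3 ≤ s) (hls : 2236 / 1000 * l ≤ s) :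
    0 ≤ 11 / 6 * (s - 3) - 3 / 2 * l + 2 * √l := by
  have ht := Real.sqrt_pos.2 hl
  have ht2 := Real.sq_sqrt hl.le
  rcases le_or_gt √l (4 / 3) with h | h <;> nlinarith

lemma sub_three_le_exponent {l s : ℝ} (hl : 0 < l) (hs : 3 ≤ s) (hls : 2236 / 1000 * l ≤ s) :
    l - 3 ≤ 11 / 6 * (s - 3) - 3 / 2 * l + 2 * √l := by
  have ht := Real.sqrt_pos.2 hl
  have ht2 := Real.sq_sqrt hl.le
  rcases le_or_gt √l 1 with h | h <;> nlinarith

/-- With s = √(ln), the hypotheses give s ≥ 3 and s ≥ √5 l, where 2236/1000 < √5. It remains that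
(4/5) e^6 > 250 and (4/5) e^3 > 16, the latter barely. -/
lemma le_cL_mul {l : ℝ} (hl : 0 < l) {n : ℕ} (hn : 0 < n) (h5 : 5 * l ≤ n) (h9 : 9 ≤ l * n) :
    250 ≤ cL l * (n : ℝ) ^ (-(1 / 4) : ℝ) * Real.exp (2 * √(l * n)) ∧
    16 * Real.exp l ≤ cL l * (n : ℝ) ^ (-(1 / 4) : ℝ) * Real.exp (2 * √(l * n)) := by
  have key := exp_le_cL_mul hl hn
  have hs : 3 ≤ √(l * n) := by
    rw [Real.le_sqrt' (by norm_num)]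
    linarith
  have hls : 2236 / 1000 * l ≤ √(l * n) := by
    refine Real.le_sqrt_of_sq_le ?_
    nlinarith
  have he : (2.7182 : ℝ) ≤ Real.exp 1 := by linarith [Real.exp_one_gt_d9]
  constructor
  · refine le_trans ?_ key
    have h1 : Real.exp 6 ≤ Real.exp (6 + (11 / 6 * (√(l * n) - 3) - 3 / 2 * l + 2 * √l)) :=
      Real.exp_le_exp.2 (by linarith [exponent_nonneg hl hs hls])
    have h2 : (2.7182 : ℝ) ^ 6 ≤ Real.exp 6 := by
      rw [show (6 : ℝ) = ((6 : ℕ) : ℝ) * 1 by norm_num, Real.exp_nat_mul]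
      gcongr
    norm_num at h2
    linarith
  · refine le_trans ?_ key
    have h1 : Real.exp (3 + l) ≤
        Real.exp (6 + (11 / 6 * (√(l * n) - 3) - 3 / 2 * l + 2 * √l)) :=
      Real.exp_le_exp.2 (by linarith [sub_three_le_exponent hl hs hls])
    have h2 : (2.7182 : ℝ) ^ 3 ≤ Real.exp 3 := by
      rw [show (3 : ℝ) = ((3 : ℕ) : ℝ) * 1 by norm_num, Real.exp_nat_mul]
      gcongr
    norm_num at h2
    rw [Real.exp_add] at h1
    nlinarith [Real.exp_pos l]

lemma sq_upper_bound {ε τ : ℝ} (hε : 0 < ε) (hτ : 0 < τ) (n : ℕ) (a b : ℝ) :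
    (a * √(cL (τ ^ 2 * ε ^ 2)) * (n : ℝ) ^ (-(1 / 8) : ℝ) * Real.exp (τ * ε * √(n : ℝ)) *
      (b * (τ * ε)) ^ n * (n.factorial : ℝ) ^ (-(1 / 2) : ℝ)) ^ 2 =
    (τ ^ 2 * ε ^ 2) ^ n / n.factorial * (a ^ 2 * (b ^ 2) ^ n * (cL (τ ^ 2 * ε ^ 2) *
      (n : ℝ) ^ (-(1 / 4) : ℝ) * Real.exp (2 * √(τ ^ 2 * ε ^ 2 * n)))) := by
  have hl0 : 0 < τ ^ 2 * ε ^ 2 := by positivity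
  have hc : 0 ≤ cL (τ ^ 2 * ε ^ 2) := by
    rw [cL]
    positivity
  have e1 : ((n : ℝ) ^ (-(1 / 8) : ℝ)) ^ 2 = (n : ℝ) ^ (-(1 / 4) : ℝ) := by
    rw [← Real.rpow_natCast, ← Real.rpow_mul (by positivity)]
    norm_num
  have e2 : ((n.factorial : ℝ) ^ (-(1 / 2) : ℝ)) ^ 2 = (n.factorial : ℝ)⁻¹ := by
    rw [← Real.rpow_natCast, ← Real.rpow_mul (by positivity)]
    norm_num [Real.rpow_neg_one]
  have e3 : √(τ ^ 2 * ε ^ 2 * n) = τ * ε * √n := by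
    rw [Real.sqrt_mul (by positivity), ← mul_pow, Real.sqrt_sq (by positivity)]
  have e4 : ((b * (τ * ε)) ^ n) ^ 2 = (b ^ 2) ^ n * (τ ^ 2 * ε ^ 2) ^ n := by
    rw [← pow_mul, mul_comm n 2, pow_mul, ← mul_pow]
    congr 1
    ring
  have e5 : (Real.exp (τ * ε * √n)) ^ 2 = Real.exp (2 * (τ * ε * √n)) := by
    rw [← Real.exp_nat_mul]
    norm_num
  rw [mul_pow, mul_pow, mul_pow, mul_pow, mul_pow, Real.sq_sqrt hc, e1, e2, e3, e4, e5]
  ring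

end Constants

/-! ### Assembly of the bounds -/

theorem mainTheorem8 (ε τ : ℝ) (hε : 0 < ε) (hτ : 0 < τ)
    (H : Type*) [NormedAddCommGroup H] [InnerProductSpace ℝ H] [CompleteSpace H]
    [RKHS ℝ H SymInterval ℝ] (hH : HasReproducingKernel H (analyticHermiteKernel ε τ))
    (n : ℕ) (hn : mL (τ ^ 2 * ε ^ 2) ≤ (n : ℝ)) :
    -- the kernel is the weighted power series kernel of `αₖ` and `φ`
    (∀ x y : SymInterval, analyticHermiteKernel ε τ x y =
      weightedPowerSeriesKernel (fun k => ((τ * ε) ^ (2 * k))⁻¹ * (k.factorial : ℝ))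
        (fun x => Real.exp (-(1 / 2) * ε ^ 2 * (x : ℝ) ^ 2)) x y) ∧
    -- the `n`th minimal error
    (ENNReal.ofReal
        (hermiteC1 ε τ * (τ * ε / 2) ^ n * (n.factorial : ℝ) ^ (-(1 / 2) : ℝ)) ≤
      minimalError H n ∧
    minimalError H n ≤ ENNReal.ofReal
        (hermiteC2 ε τ * (n : ℝ) ^ (-(1 / 8) : ℝ) * Real.exp (τ * ε * √(n : ℝ)) *
          (τ * ε / 2) ^ n * (n.factorial : ℝ) ^ (-(1 / 2) : ℝ))) ∧
    -- approximation at arbitrary points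
    (∀ x : Fin n → SymInterval, Function.Injective x →
      ∃ A : LinearApprox n, A.node = x ∧
        ENNReal.ofReal
            (hermiteC1 ε τ * (τ * ε / 2) ^ n * (n.factorial : ℝ) ^ (-(1 / 2) : ℝ)) ≤
          worstCaseError H A ∧
        worstCaseError H A ≤ ENNReal.ofReal
            (hermiteC2 ε τ / 2 * (n : ℝ) ^ (-(1 / 8) : ℝ) * Real.exp (τ * ε * √(n : ℝ)) *
              (2 * τ * ε) ^ n * (n.factorial : ℝ) ^ (-(1 / 2) : ℝ))) := by
  set l := τ ^ 2 * ε ^ 2 with hl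
  have hl0 : 0 < l := by positivity
  obtain ⟨h5, -, h9⟩ : 5 * l ≤ n ∧ l * (1 + l / 2) ^ 2 ≤ n ∧ 9 / l ≤ n := by
    rwa [mL, max_le_iff, max_le_iff] at hn
  replace h9 : 9 ≤ l * n := by
    rw [div_le_iff₀ hl0] at h9
    linarith
  -- The inequalities 5l ≤ n and 9 ≤ ln give n² ≥ 45.
  have hn7 : 7 ≤ n := by
    have h1 : (6 : ℝ) < n := by
      by_contra! h
      nlinarith
    have h2 : 6 < n := by exact_mod_cast h1
    omega
  have hn0 : 0 < n := by omega
  have hT := le_cL_mul hl0 hn0 h5 h9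
  set T := cL l * (n : ℝ) ^ (-(1 / 4) : ℝ) * Real.exp (2 * √(l * n)) with hTdef
  refine ⟨analyticHermiteKernel_eq_weightedPowerSeriesKernel, ⟨?_, ?_⟩, fun x hx => ?_⟩
  · exact le_iInf fun A => A.lower_bound_worstCaseError hε hτ hH hn7 h5
  · refine (iInf_le _ (weightedInterpolation ε τ 0 _ (chebyshevNode_injective n))).trans
      (LinearApprox.worstCaseError_le _ fun x => ?_)
    refine (pow_le_pow_iff_left₀ (norm_nonneg _) (by rw [hermiteC2]; positivity) two_ne_zero).1 ?_
    refine (norm_residual_chebyshevNode_sq_le hε hτ hH hn0 h5 x).trans ?_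
    have h := sq_upper_bound hε hτ n 2 (1 / 2)
    rw [one_div_mul_eq_div] at h
    rw [hermiteC2, h, ← hl, ← hTdef]
    gcongr
    rw [show ((1 / 2 : ℝ) ^ 2) ^ n = 1 / 4 ^ n by rw [← one_div_pow]; norm_num, mul_one_div,
      div_mul_eq_mul_div]
    refine div_le_div_of_nonneg_right ?_ (by positivity)
    linarith [hT.2]
  · refine ⟨weightedInterpolation ε τ (-1) x hx, rfl,
      LinearApprox.lower_bound_worstCaseError hε hτ hH hn7 h5 _,
      LinearApprox.worstCaseError_le _ fun y => ?_⟩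
    refine (pow_le_pow_iff_left₀ (norm_nonneg _) (by rw [hermiteC2]; positivity) two_ne_zero).1 ?_
    refine (norm_residual_sq_le_of_injective hH hn0 h5 hx y).trans ?_
    have h := sq_upper_bound hε hτ n 1 2
    rw [one_mul, ← mul_assoc 2 τ ε] at h
    rw [hermiteC2, mul_div_cancel_left₀ _ two_ne_zero, h, ← hl, ← hTdef]
    gcongr
    norm_num
    linarith [hT.1]
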